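/- Let $S$ be a uniquely ergodic continuous map of a compact metric space $Y$, and let $\nu$ be its unique invariant Borel probability measure. Let $E_0\subset\mathbb S^1$ be the set of eigenvalues of $f\mapsto f\circ S$ on $L^2(Y,\nu)$, regarded as constant functions, and for $k\ge 1$ let $E_k$ be the set of all $f\in L^2(Y,\nu)$ with $|f|=1$ a.e. and $(f\circ S)/f\in E_{k-1}$. Assume that $(Y,\nu,S)$ has quasi-discrete spectrum, that is, $S^m$ is ergodic with respect to $\nu$ for every $m\ge 1$, and the linear span of $\bigcup_{k\ge 0}E_k$ is dense in $L^2(Y,\nu)$. Then, for every multiplicative function $\boldsymbol{\nu}:\mathbb N\to\mathbb C$ (i.e. $\boldsymbol\nu(1)=1$ and $\boldsymbol{\nu}(mn)=\boldsymbol{\nu}(m)\boldsymbol{\nu}(n)$ for coprime $m,n\geq 1$) with $|\boldsymbol\nu|\le 1$, every $f\in C(Y)$ with $\int_Y f\,d\nu=0$ and every $y\in Y$, $$\lim_{N\to\infty}\frac1N\sum_{1\le n\le N} f(S^ny)\,\boldsymbol{\nu}(n)=0 .$$ In particular, Sarnak's conjecture holds for $(Y,S)$: for every $f\in C(Y)$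 (with no condition on $\int_Y f\,d\nu$) and every $y\in Y$, $$\lim_{N\to\infty}\frac1N\sum_{1\le n\le N} f(S^ny)\,\boldsymbol{\mu}(n)=0,$$ where $\boldsymbol{\mu}$ is the Möbius function. -/

import Mathlib

open MeasureTheory

/-- `T` is uniquely ergodic: it has exactly one invariant probability measure. -/
def IsUniquelyErgodic {Y : Type*} [MeasurableSpace Y] (T : Y → Y) : Prop :=
  ∃! μ : Measure Y, IsProbabilityMeasure μ ∧ MeasurePreserving T μ μ

/-- All non-trivial powers of `T` are ergodic for `μ`. -/
def IsTotallyErgodic {X : Type*} [MeasurableSpace X] (T : X → X) (μ : Measure X) : Prop :=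
  ∀ m : ℕ, m ≠ 0 → Ergodic T^[m] μ

/-- `c` is an eigenvalue of the operator `f ↦ f ∘ T` on `L²(μ)`. -/
def IsKoopmanEigenvalue {X : Type*} [MeasurableSpace X] (T : X → X) (μ : Measure X) (c : ℂ) :
    Prop :=
  ∃ f : Lp ℂ 2 μ, f ≠ 0 ∧ (fun x => f (T x)) =ᵐ[μ] fun x => c * f x

/-- The sets `E_k(T)` in `L²(μ)`. `E_0(T)` consists of the eigenvalues of `T`, seen as constant
functions; `E_{k+1}(T)` consists of the `f` with `|f| = 1` such that `f ∘ T / f ∈ E_k(T)`. -/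
def quasiEigenfunctions {X : Type*} [MeasurableSpace X] (T : X → X) (μ : Measure X) :
    ℕ → Set (Lp ℂ 2 μ)
  | 0 => {g | ∃ c : ℂ, IsKoopmanEigenvalue T μ c ∧ g =ᵐ[μ] fun _ => c}
  | k + 1 => {f | (∀ᵐ x ∂μ, ‖f x‖ = 1) ∧
      ∃ g ∈ quasiEigenfunctions T μ k, (fun x => f (T x) / f x) =ᵐ[μ] g}

/-- `T` is totally ergodic and its quasi-eigenfunctions are linearly dense in `L²(μ)`. -/
structure HasQuasiDiscreteSpectrum {X : Type*} [MeasurableSpace X] (T : X → X) (μ : Measure X) :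
    Prop where
  totallyErgodic : IsTotallyErgodic T μ
  dense_span :
    (Submodule.span ℂ (⋃ k : ℕ, quasiEigenfunctions T μ k)).topologicalClosure = ⊤

/-!
By the orthogonality criterion of Kátai, Bourgain, Sarnak and Ziegler it is enough that, given
`ε > 0`, for distinct large primes `p` and `q` the averages of `f (S^{pn} y) * conj (f (S^{qn} y))`
are eventually at most `ε`. These averages are governed by the weak limits of the empirical
measures of `(y, y)` under `S^p × S^q`, and by total and unique ergodicity each such limit is a
joining of `(ν, S^p)` and `(ν, S^q)`. By density, `f` is close in `L²` to a combination of
functions of modulus one whose iterated multiplicative derivative `u ∘ S / u` is, after finitely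
many steps, a constant of infinite order. For two such functions `u` and `v`, with leading
constants `a` and `b` in degree `k`, the function `v z / u x` on a joining has leading constant
`b ^ q ^ k / a ^ p ^ k`, which has infinite order for all distinct large `p` and `q`. Then its
integral vanishes, by induction on the degree and an argument in the spirit of van der Corput.

For a function with nonzero mean, the Möbius function itself must have mean zero: this follows from
the nonvanishing of `ζ` on `re s = 1` by a Tauberian argument resting on the Riemann–Lebesgue lemma.
-/

open Filter Topology

/-- The filter of pairs of distinct primes both tending to infinity, along which the correlations
in the Kátai–Bourgain–Sarnak–Ziegler criterion have to vanish. -/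
def distinctPrimePairs : Filter (ℕ × ℕ) :=
  atTop ⊓ 𝓟 {x | x.1.Prime ∧ x.2.Prime ∧ x.1 ≠ x.2}

theorem eventually_distinctPrimePairs_iff {P : ℕ × ℕ → Prop} :
    (∀ᶠ x in distinctPrimePairs, P x) ↔
      ∃ K, ∀ p q : ℕ, p.Prime → q.Prime → p ≠ q → K ≤ p → K ≤ q → P (p, q) := by
  rw [distinctPrimePairs, eventually_inf_principal, eventually_atTop_prod_self']
  exact ⟨fun ⟨K, h⟩ => ⟨K, fun p q hp hq hne hKp hKq => h p hKp q hKq ⟨hp, hq, hne⟩⟩,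
    fun ⟨K, h⟩ => ⟨K, fun p hKp q hKq hpq => h p q hpq.1 hpq.2.1 hpq.2.2 hKp hKq⟩⟩

theorem eventually_distinctPrimePairs_prime :
    ∀ᶠ x in distinctPrimePairs, x.1.Prime ∧ x.2.Prime ∧ x.1 ≠ x.2 :=
  mem_inf_of_right (mem_principal_self _)

section Phases

variable {A B : Type*} [CommGroup A] [CommGroup B]

/-- The multiplicative derivative `f ↦ φ f / f` along an endomorphism `φ` of a commutative group.
For `φ f = f ∘ T` these are the quotients defining the sets `E_k(T)`. -/
def mulDiff (φ : Monoid.End A) : Monoid.End A where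
  toFun f := φ f / f
  map_one' := by simp
  map_mul' f g := by rw [map_mul, mul_div_mul_comm]

theorem mulDiff_apply (φ : Monoid.End A) (f : A) : mulDiff φ f = φ f / f := rfl

theorem pow_apply_div_self (φ : Monoid.End A) (n : ℕ) (f : A) :
    (φ ^ n) f / f = ∏ i ∈ Finset.range n, (φ ^ i) (mulDiff φ f) := by
  have hstep : ∀ i, (φ ^ i) (mulDiff φ f) = (φ ^ (i + 1)) f / (φ ^ i) f := fun i => by
    rw [mulDiff_apply, map_div, pow_succ, Monoid.End.coe_mul, Function.comp_apply]
  simp only [hstep]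
  rw [Finset.prod_range_div fun i => (φ ^ i) f, pow_zero, Monoid.End.coe_one, id]

theorem map_mulDiff_pow {φ : Monoid.End A} {ψ : Monoid.End B} (π : A →* B)
    (h : ∀ f, π (φ f) = ψ (π f)) (k : ℕ) (f : A) :
    π ((mulDiff φ ^ k) f) = (mulDiff ψ ^ k) (π f) := by
  have hΔ : Function.Semiconj π (mulDiff φ) (mulDiff ψ) := fun f => by
    simp only [mulDiff_apply, map_div, h]
  simpa only [Monoid.End.coe_pow] using hΔ.iterate_right k f

/-- `f` is a polynomial phase of degree at most `k` for the endomorphism `φ`, with leading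
coefficient `c`: its `k`-th multiplicative derivative is the `φ`-invariant element `c`. -/
structure IsPhase (φ : Monoid.End A) (k : ℕ) (c f : A) : Prop where
  map_coeff : φ c = c
  mulDiff_pow_apply : (mulDiff φ ^ k) f = c

namespace IsPhase

variable {φ : Monoid.End A} {ψ : Monoid.End B} {k l : ℕ} {c d f g : A}

theorem div (hf : IsPhase φ k c f) (hg : IsPhase φ k d g) : IsPhase φ k (c / d) (f / g) :=
  ⟨by rw [map_div, hf.1, hg.1], by rw [map_div, hf.2, hg.2]⟩

theorem map (hf : IsPhase φ k c f) (π : A →* B) (h : ∀ f, π (φ f) = ψ (π f)) :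
    IsPhase ψ k (π c) (π f) :=
  ⟨by rw [← h, hf.1], by rw [← map_mulDiff_pow π h, hf.2]⟩

theorem pow_apply (hf : IsPhase φ k c f) (n : ℕ) : IsPhase φ k c ((φ ^ n) f) := by
  have hcomm : Commute (φ ^ n) φ := (Commute.refl φ).pow_left n
  have hc : (φ ^ n) c = c := by
    rw [Monoid.End.coe_pow]; exact Function.iterate_fixed hf.1 n
  exact hc ▸ hf.map (φ ^ n) (DFunLike.congr_fun hcomm.eq)

theorem mulDiff (hf : IsPhase φ (k + 1) c f) : IsPhase φ k c (mulDiff φ f) :=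
  ⟨hf.1, by rw [← hf.2, pow_succ, Monoid.End.coe_mul, Function.comp_apply]⟩

theorem of_lt (hf : IsPhase φ k c f) (hkl : k < l) : IsPhase φ l 1 f := by
  obtain ⟨m, rfl⟩ := Nat.exists_eq_add_of_lt hkl
  refine ⟨map_one φ, ?_⟩
  rw [show k + m + 1 = m + (1 + k) by ring, pow_add, pow_add, pow_one]
  simp only [Monoid.End.coe_mul, Function.comp_apply, hf.2, mulDiff_apply, hf.1, div_self', map_one]

protected theorem prod {ι : Type*} (s : Finset ι) {f : ι → A} (hf : ∀ i ∈ s, IsPhase φ k c (f i)) :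
    IsPhase φ k (c ^ s.card) (∏ i ∈ s, f i) := by
  classical
  induction s using Finset.induction_on with
  | empty => exact ⟨by simp, by simp⟩
  | insert i s hi ih =>
    have h₁ := hf i (Finset.mem_insert_self i s)
    have h₂ := ih fun j hj => hf j (Finset.mem_insert_of_mem hj)
    rw [Finset.prod_insert hi, Finset.card_insert_of_notMem hi, pow_succ']
    exact ⟨by rw [map_mul, h₁.1, h₂.1], by rw [map_mul, h₁.2, h₂.2]⟩

theorem pow_apply_div_self (hf : IsPhase φ (k + 1) c f) (n : ℕ) :
    IsPhase φ k (c ^ n) ((φ ^ n) f / f) := by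
  rw [_root_.pow_apply_div_self]
  simpa only [Finset.card_range] using
    IsPhase.prod (Finset.range n) fun i _ => hf.mulDiff.pow_apply i

theorem pow (hf : IsPhase φ k c f) (p : ℕ) : IsPhase (φ ^ p) k (c ^ p ^ k) f := by
  have hc : (φ ^ p) c = c := by
    rw [Monoid.End.coe_pow]; exact Function.iterate_fixed hf.1 p
  refine ⟨by rw [map_pow, hc], ?_⟩
  induction k generalizing f with
  | zero => simpa using hf.2
  | succ k ih =>
    rw [pow_succ, Monoid.End.coe_mul, Function.comp_apply, mulDiff_apply,
      _root_.pow_apply_div_self, map_prod]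
    simp only [fun i => ih (hf.mulDiff.pow_apply i), Finset.prod_const, Finset.card_range,
      ← pow_mul, ← pow_succ]

end IsPhase

theorem isOfFinOrder_of_pow_div_pow {a : A} {m n : ℕ} (h : IsOfFinOrder (a ^ m / a ^ n))
    (hmn : m ≠ n) : IsOfFinOrder a := by
  by_contra ha
  obtain ⟨r, hr, hpow⟩ := isOfFinOrder_iff_pow_eq_one.mp h
  rw [div_pow, ← pow_mul, ← pow_mul, div_eq_one] at hpow
  exact hmn (Nat.eq_of_mul_eq_mul_right hr (injective_pow_iff_not_isOfFinOrder.mpr ha hpow))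

theorem eventually_not_isOfFinOrder_pow_div_pow {a b : A}
    (hab : ¬IsOfFinOrder a ∨ ¬IsOfFinOrder b) {k : ℕ} (hk : k ≠ 0) :
    ∀ᶠ x in distinctPrimePairs, ¬IsOfFinOrder (a ^ x.1 ^ k / b ^ x.2 ^ k) := by
  by_contra hfreq
  rw [eventually_distinctPrimePairs_iff] at hfreq
  push Not at hfreq
  obtain ⟨p₀, q₀, hp₀, -, -, -, -, h₀⟩ := hfreq 0
  obtain ⟨p, q, hp, hq, hne, hlt, -, h⟩ := hfreq (p₀ + 1)
  have ha : ¬IsOfFinOrder a := fun ha => by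
    have hb : IsOfFinOrder (b ^ q ^ k) := by
      simpa using (ha.pow (n := p ^ k)).mul h.inv
    rw [isOfFinOrder_pow] at hb
    exact hab.elim (· ha) (· (hb.resolve_right (pow_ne_zero k hq.ne_zero)))
  refine ha (isOfFinOrder_of_pow_div_pow (m := p ^ k * q₀ ^ k) (n := p₀ ^ k * q ^ k) ?_ ?_)
  · have hdiv := (h.pow (n := q₀ ^ k)).mul (h₀.pow (n := q ^ k)).inv
    rwa [div_pow, div_pow, ← pow_mul, ← pow_mul, ← pow_mul, ← pow_mul, mul_comm (q₀ ^ k) (q ^ k),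
      ← div_eq_mul_inv, div_div_div_cancel_right] at hdiv
  · rw [← mul_pow, ← mul_pow]
    intro heq
    have hdvd : p ∣ p₀ * q := Dvd.intro _ (Nat.pow_left_injective hk heq)
    rcases hp.dvd_mul.mp hdvd with hpp₀ | hpq
    · exact absurd (Nat.le_of_dvd hp₀.pos hpp₀) (by omega)
    · exact hne ((Nat.prime_dvd_prime_iff_eq hp hq).mp hpq)

end Phases

section InnerProduct

variable {𝕜 E F ι : Type*} [RCLike 𝕜] [NormedAddCommGroup E] [InnerProductSpace 𝕜 E]
  [NormedAddCommGroup F] [InnerProductSpace 𝕜 F]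

/- The orbit of `g` is orthogonal with constant norm, and all its elements have the same inner
product with `e`, so Bessel's inequality forces that inner product to vanish. -/
theorem inner_eq_zero_of_inner_iterate_eq_zero (U : E →ₗᵢ[𝕜] E) {e g : E} (he : U e = e)
    (hg : ∀ n ≠ 0, inner 𝕜 g (U^[n] g) = 0) : inner 𝕜 e g = 0 := by
  rcases eq_or_ne g 0 with rfl | hg0
  · exact inner_zero_right e
  have hU : ∀ n x y, inner 𝕜 (U^[n] x) (U^[n] y) = inner 𝕜 x y := fun n x y => by
    induction n with
    | zero => rfl
    | succ n ih => rw [Function.iterate_succ_apply', Function.iterate_succ_apply', U.inner_map_map,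
        ih]
  have hnorm : ∀ n, ‖U^[n] g‖ = ‖g‖ := fun n => by
    rw [norm_eq_sqrt_re_inner (𝕜 := 𝕜), hU, ← norm_eq_sqrt_re_inner]
  have hlt : ∀ m n, m < n → inner 𝕜 (U^[m] g) (U^[n] g) = 0 := fun m n hmn => by
    obtain ⟨r, rfl⟩ := Nat.exists_eq_add_of_lt hmn
    rw [add_assoc, Function.iterate_add_apply, hU, hg _ r.succ_ne_zero]
  have hne : ∀ m n, m ≠ n → inner 𝕜 (U^[m] g) (U^[n] g) = 0 := fun m n hmn =>
    hmn.lt_or_gt.elim (hlt m n) fun h => inner_eq_zero_symm.mp (hlt n m h)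
  have horth : Orthonormal 𝕜 fun n : ℕ => (‖g‖⁻¹ : 𝕜) • U^[n] g :=
    ⟨fun n => by simp [norm_smul, hnorm, hg0],
      fun m n hmn => by simp [inner_smul_left, inner_smul_right, hne m n hmn]⟩
  have hconst : ∀ n, inner 𝕜 (U^[n] g) e = inner 𝕜 g e := fun n => by
    rw [← hU n g e, Function.iterate_fixed he]
  have hsum := horth.inner_products_summable e
  simp only [inner_smul_left, hconst, summable_const_iff] at hsum
  simpa [hg0, inner_eq_zero_symm] using hsum

theorem mem_topologicalClosure_of_mem_orthogonal {P K : Submodule 𝕜 E} [K.HasOrthogonalProjection]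
    (hP : P ≤ Kᗮ) (hPK : (P ⊔ K).topologicalClosure = ⊤) {f : E} (hf : f ∈ Kᗮ) :
    f ∈ P.topologicalClosure := by
  have hmaps : Set.MapsTo Kᗮ.starProjection (P ⊔ K : Submodule 𝕜 E) P := fun x hx => by
    obtain ⟨y, hy, z, hz, rfl⟩ := Submodule.mem_sup.mp hx
    rwa [map_add, Submodule.starProjection_eq_self_iff.mpr (hP hy),
      Submodule.starProjection_orthogonal_apply_eq_zero hz, add_zero]
  have hmem : f ∈ (P ⊔ K).topologicalClosure := hPK ▸ Submodule.mem_top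
  rw [← Submodule.starProjection_eq_self_iff.mpr hf]
  exact map_mem_closure Kᗮ.starProjection.continuous hmem hmaps

variable {H : ι → Type*} [∀ i, NormedAddCommGroup (H i)] [∀ i, InnerProductSpace 𝕜 (H i)]
  {l : Filter ι}

theorem tendsto_inner_zero_of_mem_closure_span {s : Set E} {x : ∀ i, H i} {C : ℝ}
    (hx : ∀ i, ‖x i‖ ≤ C) (V : ∀ i, E →ₗᵢ[𝕜] H i)
    (hs : ∀ f ∈ s, Tendsto (fun i => inner 𝕜 (x i) (V i f)) l (𝓝 0)) {f : E}
    (hf : f ∈ (Submodule.span 𝕜 s).topologicalClosure) :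
    Tendsto (fun i => inner 𝕜 (x i) (V i f)) l (𝓝 0) := by
  have hspan : ∀ w ∈ Submodule.span 𝕜 s, Tendsto (fun i => inner 𝕜 (x i) (V i w)) l (𝓝 0) := by
    intro w hw
    induction hw using Submodule.span_induction with
    | mem w hw => exact hs w hw
    | zero => simpa using tendsto_const_nhds
    | add w₁ w₂ _ _ h₁ h₂ => simpa [inner_add_right] using h₁.add h₂
    | smul a w _ h => simpa [inner_smul_right] using h.const_mul a
  rw [NormedAddGroup.tendsto_nhds_zero]
  intro ε hε
  have hδ : 0 < ε / 2 / (|C| + 1) := by positivity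
  obtain ⟨w, hw, hfw⟩ := Metric.mem_closure_iff.mp hf _ hδ
  filter_upwards [NormedAddGroup.tendsto_nhds_zero.mp (hspan w hw) _ (half_pos hε)] with i hi
  have hsub : ‖inner 𝕜 (x i) (V i (f - w))‖ ≤ ε / 2 :=
    calc ‖inner 𝕜 (x i) (V i (f - w))‖ ≤ ‖x i‖ * ‖f - w‖ := by
          simpa only [(V i).norm_map] using norm_inner_le_norm (𝕜 := 𝕜) (x i) (V i (f - w))
      _ ≤ (|C| + 1) * (ε / 2 / (|C| + 1)) := by
          rw [← dist_eq_norm]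
          gcongr
          linarith [hx i, le_abs_self C]
      _ = ε / 2 := by field_simp
  calc ‖inner 𝕜 (x i) (V i f)‖ = ‖inner 𝕜 (x i) (V i (f - w)) + inner 𝕜 (x i) (V i w)‖ := by
        rw [← inner_add_right, ← map_add, sub_add_cancel]
    _ < ε := (norm_add_le _ _).trans_lt (by linarith)

theorem tendsto_inner_zero_of_mem_closure_span₂ {s : Set E} {t : Set F} (V : ∀ i, E →ₗᵢ[𝕜] H i)
    (W : ∀ i, F →ₗᵢ[𝕜] H i)
    (hst : ∀ f ∈ s, ∀ g ∈ t, Tendsto (fun i => inner 𝕜 (V i f) (W i g)) l (𝓝 0)) {f : E} {g : F}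
    (hf : f ∈ (Submodule.span 𝕜 s).topologicalClosure)
    (hg : g ∈ (Submodule.span 𝕜 t).topologicalClosure) :
    Tendsto (fun i => inner 𝕜 (V i f) (W i g)) l (𝓝 0) := by
  have hswap : ∀ f g, Tendsto (fun i => inner 𝕜 (V i f) (W i g)) l (𝓝 0) ↔
      Tendsto (fun i => inner 𝕜 (W i g) (V i f)) l (𝓝 0) := fun f g => by
    rw [tendsto_zero_iff_norm_tendsto_zero,
      tendsto_zero_iff_norm_tendsto_zero (f := fun i => inner 𝕜 (W i g) (V i f))]
    simp only [norm_inner_symm (𝕜 := 𝕜) (V _ f)]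
  refine tendsto_inner_zero_of_mem_closure_span (fun i => ((V i).norm_map f).le) W
    (fun g hg => (hswap f g).mpr ?_) hg
  exact tendsto_inner_zero_of_mem_closure_span (fun i => ((W i).norm_map g).le) V
    (fun f hf => (hswap f g).mp (hst f hf g hg)) hf

end InnerProduct

section Pullback

variable {W X Z G : Type*} [MeasurableSpace W] [MeasurableSpace X] [MeasurableSpace Z]
  {κ : Measure W} {μ : Measure X} {ν : Measure Z} [TopologicalSpace G] [CommGroup G]
  [IsTopologicalGroup G]

/-- Composition with a quasi-measure-preserving map, as a homomorphism between the groups of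
`G`-valued functions modulo almost everywhere equality. -/
def pullback {T : X → Z} (hT : Measure.QuasiMeasurePreserving T μ ν) :
    (Z →ₘ[ν] G) →* (X →ₘ[μ] G) where
  toFun u := u.compQuasiMeasurePreserving T hT
  map_one' := rfl
  map_mul' u v := by
    induction u, v using AEEqFun.induction_on₂ with
    | _ f hf g hg => rfl

theorem pullback_apply {T : X → Z} (hT : Measure.QuasiMeasurePreserving T μ ν) (u : Z →ₘ[ν] G) :
    pullback hT u = u.compQuasiMeasurePreserving T hT := rfl

theorem pullback_comp {T : X → Z} {T' : W → X} (hT : Measure.QuasiMeasurePreserving T μ ν)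
    (hT' : Measure.QuasiMeasurePreserving T' κ μ) (u : Z →ₘ[ν] G) :
    pullback (hT.comp hT') u = pullback hT' (pullback hT u) := by
  induction u using AEEqFun.induction_on with
  | _ f hf => rfl

/-- The Koopman operator `u ↦ u ∘ T` on `G`-valued functions modulo almost everywhere equality, as
an endomorphism of the group of these functions. -/
def koopman {T : X → X} (hT : Measure.QuasiMeasurePreserving T μ μ) : Monoid.End (X →ₘ[μ] G) :=
  pullback hT

theorem koopman_apply {T : X → X} (hT : Measure.QuasiMeasurePreserving T μ μ) (u : X →ₘ[μ] G) :
    koopman hT u = pullback hT u := rfl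

theorem koopman_iterate {T : X → X} (hT : Measure.QuasiMeasurePreserving T μ μ) (n : ℕ) :
    koopman (hT.iterate n) = (koopman hT : Monoid.End (X →ₘ[μ] G)) ^ n := by
  ext1 u
  rw [Monoid.End.coe_pow]
  exact (u.compQuasiMeasurePreserving_iterate hT n).symm

theorem pullback_koopman {T : X → X} {R : Z → Z} {π : X → Z}
    (hT : Measure.QuasiMeasurePreserving T μ μ) (hR : Measure.QuasiMeasurePreserving R ν ν)
    (hπ : Measure.QuasiMeasurePreserving π μ ν) (h : R ∘ π = π ∘ T) (u : Z →ₘ[ν] G) :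
    pullback hπ (koopman hR u) = koopman hT (pullback hπ u) := by
  simp only [koopman_apply, ← pullback_comp, h]

/-- The embedding of `G` into the group of `G`-valued functions as constant functions. -/
def constHom (μ : Measure X) : G →* (X →ₘ[μ] G) where
  toFun a := AEEqFun.const X a
  map_one' := rfl
  map_mul' _ _ := rfl

theorem pullback_constHom {T : X → Z} (hT : Measure.QuasiMeasurePreserving T μ ν) (a : G) :
    pullback hT (constHom ν a) = constHom μ a := rfl

theorem IsPhase.pullback_of_iterate {T : X → X} {R : Z → Z} {π : X → Z}
    {hR : Measure.QuasiMeasurePreserving R ν ν} {k : ℕ} {a : G} {v : Z →ₘ[ν] G}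
    (hv : IsPhase (koopman hR) k (constHom ν a) v) (hT : Measure.QuasiMeasurePreserving T μ μ)
    (hπ : Measure.QuasiMeasurePreserving π μ ν) {p : ℕ} (h : R^[p] ∘ π = π ∘ T) :
    IsPhase (koopman hT) k (constHom μ (a ^ p ^ k)) (pullback hπ v) := by
  have hvp := hv.pow p
  rw [← koopman_iterate, ← map_pow] at hvp
  exact hvp.map (pullback hπ) (pullback_koopman hT (hR.iterate p) hπ h)

/-- `u` is a polynomial phase of positive degree along `T` whose leading coefficient is a constant
of infinite order. Circle-valued such functions are orthogonal to the constants. -/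
def IsNontrivialPhase {T : X → X} (hT : Measure.QuasiMeasurePreserving T μ μ) (u : X →ₘ[μ] G) :
    Prop :=
  ∃ (k : ℕ) (a : G), ¬IsOfFinOrder a ∧
    IsPhase (koopman hT) (k + 1) (constHom μ a) u

namespace IsNontrivialPhase

variable {T : X → X} {hT : Measure.QuasiMeasurePreserving T μ μ} {u : X →ₘ[μ] G}

theorem of_mulDiff (hu : IsNontrivialPhase hT (mulDiff (koopman hT) u)) :
    IsNontrivialPhase hT u := by
  obtain ⟨k, a, ha, hcoeff, hpow⟩ := hu
  exact ⟨k + 1, a, ha, hcoeff, hpow⟩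

theorem of_mulDiff_eq_constHom {a : G} (ha : ¬IsOfFinOrder a)
    (hu : mulDiff (koopman hT) u = constHom μ a) : IsNontrivialPhase hT u :=
  ⟨0, a, ha, pullback_constHom hT a, hu⟩

/- In different degrees, the phase of lower degree has trivial coefficient in the larger degree. -/
theorem exists_common_degree {R : Z → Z} {hR : Measure.QuasiMeasurePreserving R ν ν} {v : Z →ₘ[ν] G}
    (hu : IsNontrivialPhase hT u) (hv : IsNontrivialPhase hR v) :
    ∃ (k : ℕ) (a b : G), (¬IsOfFinOrder a ∨ ¬IsOfFinOrder b) ∧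
      IsPhase (koopman hT) (k + 1) (constHom μ a) u ∧
      IsPhase (koopman hR) (k + 1) (constHom ν b) v := by
  obtain ⟨k, a, ha, hu⟩ := hu
  obtain ⟨l, b, hb, hv⟩ := hv
  rcases lt_trichotomy k l with hkl | rfl | hkl
  · exact ⟨l, 1, b, Or.inr hb, hu.of_lt (Nat.succ_lt_succ hkl), hv⟩
  · exact ⟨k, a, b, Or.inl ha, hu, hv⟩
  · exact ⟨k, a, 1, Or.inl ha, hu, hv.of_lt (Nat.succ_lt_succ hkl)⟩

end IsNontrivialPhase

end Pullback

section CircleValued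

variable {X Z : Type*} [MeasurableSpace X] [MeasurableSpace Z] {μ : Measure X} {ν : Measure Z}
  [IsFiniteMeasure μ] [IsFiniteMeasure ν]

/-- A circle-valued function, viewed as an element of `L²`. -/
noncomputable def circleToL2 (u : X →ₘ[μ] Circle) : Lp ℂ 2 μ :=
  (MemLp.of_bound (f := fun x => (u x : ℂ))
    (continuous_subtype_val.comp_aestronglyMeasurable u.aestronglyMeasurable) 1
    (.of_forall fun x => (u x).norm_coe.le)).toLp

theorem coeFn_circleToL2 (u : X →ₘ[μ] Circle) : circleToL2 u =ᵐ[μ] fun x => (u x : ℂ) :=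
  MemLp.coeFn_toLp _

theorem exists_circleToL2_eq {f : Lp ℂ 2 μ} (hf : ∀ᵐ x ∂μ, ‖f x‖ = 1) :
    ∃ u : X →ₘ[μ] Circle, circleToL2 u = f := by
  have hm : AEStronglyMeasurable (fun x => Circle.exp (f x).arg) μ :=
    Circle.exp.continuous.comp_aestronglyMeasurable
      (Lp.aestronglyMeasurable f).aemeasurable.carg.aestronglyMeasurable
  refine ⟨AEEqFun.mk _ hm, Lp.ext ?_⟩
  filter_upwards [coeFn_circleToL2 (AEEqFun.mk _ hm), AEEqFun.coeFn_mk _ hm, hf] with x h₁ h₂ h₃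
  rw [h₁, h₂, Circle.coe_exp]
  simpa [h₃] using Complex.norm_mul_exp_arg_mul_I (f x)

theorem circleToL2_constHom_mul (a : Circle) (u : X →ₘ[μ] Circle) :
    circleToL2 (constHom μ a * u) = (a : ℂ) • circleToL2 u := by
  refine Lp.ext ?_
  filter_upwards [coeFn_circleToL2 (constHom μ a * u), AEEqFun.coeFn_mul (constHom μ a) u,
    AEEqFun.coeFn_const X a, Lp.coeFn_smul (a : ℂ) (circleToL2 u), coeFn_circleToL2 u]
    with x h₁ h₂ h₃ h₄ h₅
  have h₃ : (constHom μ a : X →ₘ[μ] Circle) x = a := h₃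
  rw [h₁, h₂, h₄, Pi.mul_apply, Pi.smul_apply, h₃, h₅, Circle.coe_mul, smul_eq_mul]

theorem circleToL2_constHom (a : Circle) :
    circleToL2 (constHom μ a) = (a : ℂ) • circleToL2 (1 : X →ₘ[μ] Circle) := by
  rw [← circleToL2_constHom_mul, mul_one]

theorem inner_circleToL2_div (u v : X →ₘ[μ] Circle) :
    inner ℂ (circleToL2 1) (circleToL2 (v / u)) = inner ℂ (circleToL2 u) (circleToL2 v) := by
  simp only [L2.inner_def]
  refine integral_congr_ae ?_
  filter_upwards [coeFn_circleToL2 u, coeFn_circleToL2 v, coeFn_circleToL2 (v / u),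
    AEEqFun.coeFn_div v u, coeFn_circleToL2 (1 : X →ₘ[μ] Circle),
    AEEqFun.coeFn_one (α := X) (μ := μ) (β := Circle)] with x h₁ h₂ h₃ h₄ h₅ h₆
  rw [h₁, h₂, h₃, h₄, h₅, h₆, Pi.div_apply, div_eq_mul_inv, Circle.coe_mul,
    Circle.coe_inv_eq_conj]
  simp

theorem inner_circleToL2_one (f : Lp ℂ 2 μ) : inner ℂ (circleToL2 1) f = ∫ x, f x ∂μ := by
  rw [L2.inner_def]
  refine integral_congr_ae ?_
  filter_upwards [coeFn_circleToL2 (1 : X →ₘ[μ] Circle),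
    AEEqFun.coeFn_one (α := X) (μ := μ) (β := Circle)] with x h₁ h₂
  rw [h₁, h₂]
  simp

theorem compMeasurePreserving_circleToL2 {T : X → Z} (hT : MeasurePreserving T μ ν)
    (u : Z →ₘ[ν] Circle) :
    Lp.compMeasurePreservingₗᵢ ℂ T hT (circleToL2 u) =
      circleToL2 (pullback hT.quasiMeasurePreserving u) := by
  refine Lp.ext ?_
  have h₁ : circleToL2 u ∘ T =ᵐ[μ] (fun z => (u z : ℂ)) ∘ T :=
    hT.quasiMeasurePreserving.ae_eq_comp (coeFn_circleToL2 u)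
  filter_upwards [Lp.coeFn_compMeasurePreserving (circleToL2 u) hT, h₁,
    coeFn_circleToL2 (pullback hT.quasiMeasurePreserving u),
    u.coeFn_compQuasiMeasurePreserving hT.quasiMeasurePreserving] with x h₂ h₁ h₃ h₄
  rw [h₃, pullback_apply, h₄]
  exact h₂.trans h₁

theorem circleToL2_mulDiff {T : X → X} (hT : MeasurePreserving T μ μ) {u : X →ₘ[μ] Circle}
    {g : Lp ℂ 2 μ} (hg : (fun x => circleToL2 u (T x) / circleToL2 u x) =ᵐ[μ] g) :
    circleToL2 (mulDiff (koopman hT.quasiMeasurePreserving) u) = g := by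
  refine Lp.ext ?_
  have h₁ : circleToL2 u ∘ T =ᵐ[μ] (fun z => (u z : ℂ)) ∘ T :=
    hT.quasiMeasurePreserving.ae_eq_comp (coeFn_circleToL2 u)
  filter_upwards [coeFn_circleToL2 (mulDiff (koopman hT.quasiMeasurePreserving) u), hg,
    coeFn_circleToL2 u, h₁, AEEqFun.coeFn_div (pullback hT.quasiMeasurePreserving u) u,
    u.coeFn_compQuasiMeasurePreserving hT.quasiMeasurePreserving] with x h₂ h₃ h₄ h₁ h₅ h₆
  rw [h₂, ← h₃, h₄, mulDiff_apply, koopman_apply, h₅, Pi.div_apply, pullback_apply, h₆,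
    Circle.coe_div]
  exact congrArg (· / _) h₁.symm

theorem IsNontrivialPhase.inner_circleToL2_one_eq_zero {T : X → X} (hT : MeasurePreserving T μ μ)
    {u : X →ₘ[μ] Circle} (hu : IsNontrivialPhase hT.quasiMeasurePreserving u) :
    inner ℂ (circleToL2 1) (circleToL2 u) = 0 := by
  obtain ⟨k, a, ha, hu⟩ := hu
  have hU := compMeasurePreserving_circleToL2 hT
  set U := Lp.compMeasurePreservingₗᵢ ℂ T hT (p := 2) (E := ℂ)
  have hU1 : U (circleToL2 1) = circleToL2 1 := by rw [hU, map_one]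
  induction k generalizing a u with
  | zero =>
    have hTu : U (circleToL2 u) = (a : ℂ) • circleToL2 u := by
      rw [hU, ← koopman_apply, eq_mul_of_div_eq hu.mulDiff_pow_apply, circleToL2_constHom_mul]
    have ha1 : (1 : ℂ) - a ≠ 0 := sub_ne_zero.mpr fun h =>
      ha ((Circle.coe_injective h : 1 = a) ▸ IsOfFinOrder.one)
    have hinv : inner ℂ (circleToL2 1) (circleToL2 u) =
        a * inner ℂ (circleToL2 1) (circleToL2 u) := by
      rw [← inner_smul_right, ← hTu, ← hU1, U.inner_map_map, hU1]
    exact (mul_eq_zero.mp (by linear_combination hinv)).resolve_left ha1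
  | succ k ih =>
    -- The quotient of `u ∘ T^[n]` by `u` is a nontrivial phase of lower degree.
    refine inner_eq_zero_of_inner_iterate_eq_zero U hU1 fun n hn => ?_
    have hUn : U^[n] (circleToL2 u) =
        circleToL2 ((koopman hT.quasiMeasurePreserving ^ n) u) := by
      rw [Monoid.End.coe_pow]
      exact (Function.Semiconj.iterate_right (fun u => (hU u).symm) n u).symm
    rw [hUn, ← inner_circleToL2_div]
    refine ih (a ^ n) (fun h => ?_) (by simpa using hu.pow_apply_div_self n)
    exact ha ((isOfFinOrder_pow.mp h).resolve_right hn)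

end CircleValued

section QuasiEigenfunctions

variable {X : Type*} [MeasurableSpace X] {ν : Measure X} {S : X → X}

theorem IsKoopmanEigenvalue.norm_eq_one (hS : MeasurePreserving S ν ν) {c : ℂ}
    (hc : IsKoopmanEigenvalue S ν c) : ‖c‖ = 1 := by
  obtain ⟨f, hf0, hf⟩ := hc
  have hUf : Lp.compMeasurePreservingₗᵢ ℂ S hS f = c • f := Lp.ext <| by
    filter_upwards [Lp.coeFn_compMeasurePreserving f hS, hf, Lp.coeFn_smul c f] with x h₁ h₂ h₃
    rw [h₃]
    exact h₁.trans h₂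
  have hnorm := congrArg norm hUf
  rw [LinearIsometry.norm_map, norm_smul] at hnorm
  exact (mul_eq_right₀ (norm_ne_zero_iff.mpr hf0)).mp hnorm.symm

theorem norm_eq_one_of_mem_quasiEigenfunctions (hS : MeasurePreserving S ν ν) {k : ℕ}
    {f : Lp ℂ 2 ν} (hf : f ∈ quasiEigenfunctions S ν k) : ∀ᵐ x ∂ν, ‖f x‖ = 1 := by
  cases k with
  | zero =>
    obtain ⟨c, hc, hfc⟩ := hf
    filter_upwards [hfc] with x hx
    rw [hx, hc.norm_eq_one hS]
  | succ k => exact hf.1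

theorem IsTotallyErgodic.eq_constHom_of_mulDiff_eq_constHom (hS : IsTotallyErgodic S ν)
    (hT : Measure.QuasiMeasurePreserving S ν ν) {u : X →ₘ[ν] Circle} {a : Circle}
    (hu : mulDiff (koopman hT) u = constHom ν a) (ha : IsOfFinOrder a) :
    ∃ b, u = constHom ν b := by
  obtain ⟨m, hm, ham⟩ := isOfFinOrder_iff_pow_eq_one.mp ha
  have hphase : IsPhase (koopman hT) (0 + 1) (constHom ν a) u := ⟨pullback_constHom hT a, hu⟩
  have hinv : (koopman hT ^ m) u / u = 1 := by
    rw [← map_one (constHom ν), ← ham, map_pow]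
    exact (hphase.pow_apply_div_self m).mulDiff_pow_apply
  rw [div_eq_one, ← koopman_iterate] at hinv
  exact (hS m hm.ne').quasiErgodic.eq_const_of_compQuasiMeasurePreserving_eq hinv

variable [IsFiniteMeasure ν]

theorem circleToL2_mulDiff_mem_quasiEigenfunctions (hS : MeasurePreserving S ν ν) {k : ℕ}
    {u : X →ₘ[ν] Circle} (hu : circleToL2 u ∈ quasiEigenfunctions S ν (k + 1)) :
    circleToL2 (mulDiff (koopman hS.quasiMeasurePreserving) u) ∈ quasiEigenfunctions S ν k := by
  obtain ⟨-, g, hg, hquot⟩ := hu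
  rwa [circleToL2_mulDiff hS hquot]

theorem IsTotallyErgodic.isNontrivialPhase_or_eq_constHom (hS : IsTotallyErgodic S ν)
    (hT : MeasurePreserving S ν ν) {k : ℕ} {u : X →ₘ[ν] Circle}
    (hu : circleToL2 u ∈ quasiEigenfunctions S ν k) :
    IsNontrivialPhase hT.quasiMeasurePreserving u ∨ ∃ b, u = constHom ν b := by
  induction k generalizing u with
  | zero =>
    obtain ⟨c, hc, huc⟩ := hu
    have hcirc : c ∈ Submonoid.unitSphere ℂ := mem_sphere_zero_iff_norm.mpr (hc.norm_eq_one hT)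
    refine Or.inr ⟨⟨c, hcirc⟩, AEEqFun.ext ?_⟩
    filter_upwards [huc, coeFn_circleToL2 u,
      AEEqFun.coeFn_const (μ := ν) X (⟨c, hcirc⟩ : Circle)] with x h₁ h₂ h₃
    refine Circle.coe_injective (h₂.symm.trans (h₁.trans ?_))
    exact (congrArg ((↑) : Circle → ℂ) h₃).symm
  | succ k ih =>
    rcases ih (circleToL2_mulDiff_mem_quasiEigenfunctions hT hu) with h | ⟨a, ha⟩
    · exact Or.inl h.of_mulDiff
    · by_cases hfin : IsOfFinOrder a
      · exact Or.inr (hS.eq_constHom_of_mulDiff_eq_constHom _ ha hfin)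
      · exact Or.inl (.of_mulDiff_eq_constHom hfin ha)

theorem HasQuasiDiscreteSpectrum.mem_closure_span_of_inner_one_eq_zero
    (hS : HasQuasiDiscreteSpectrum S ν) (hT : MeasurePreserving S ν ν) {f : Lp ℂ 2 ν}
    (hf : inner ℂ (circleToL2 1) f = 0) :
    f ∈ (Submodule.span ℂ
      (circleToL2 '' {u | IsNontrivialPhase hT.quasiMeasurePreserving u})).topologicalClosure := by
  refine mem_topologicalClosure_of_mem_orthogonal (K := ℂ ∙ circleToL2 1) ?_ ?_
    (Submodule.mem_orthogonal_singleton_iff_inner_right.mpr hf)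
  · rw [Submodule.span_le]
    rintro - ⟨u, hu, rfl⟩
    exact Submodule.mem_orthogonal_singleton_iff_inner_right.mpr
      (hu.inner_circleToL2_one_eq_zero hT)
  · refine top_unique (hS.dense_span ▸ Submodule.topologicalClosure_mono
      (Submodule.span_le.mpr (Set.iUnion_subset fun k g hg => ?_)))
    obtain ⟨u, rfl⟩ := exists_circleToL2_eq (norm_eq_one_of_mem_quasiEigenfunctions hT hg)
    rcases hS.totallyErgodic.isNontrivialPhase_or_eq_constHom hT hg with hu | ⟨b, rfl⟩
    · exact Submodule.mem_sup_left (Submodule.subset_span (Set.mem_image_of_mem _ hu))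
    · rw [circleToL2_constHom]
      exact Submodule.mem_sup_right
        (Submodule.smul_mem _ _ (Submodule.mem_span_singleton_self _))

end QuasiEigenfunctions

section Joinings

variable {X Z : Type*} [MeasurableSpace X] [MeasurableSpace Z] {μ : Measure X} {ν : Measure Z}
  {T : X → X} {R : Z → Z} {κ : Measure (X × Z)}

/-- `κ` is a joining of the measure-preserving systems `(X, μ, T)` and `(Z, ν, R)`. -/
structure IsJoining (T : X → X) (μ : Measure X) (R : Z → Z) (ν : Measure Z)
    (κ : Measure (X × Z)) : Prop where
  prodMap : MeasurePreserving (Prod.map T R) κ κ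
  fst : MeasurePreserving Prod.fst κ μ
  snd : MeasurePreserving Prod.snd κ ν

namespace IsJoining

section Group

variable {G : Type*} [CommGroup G] [TopologicalSpace G] [IsTopologicalGroup G]

theorem isNontrivialPhase_div {p q k : ℕ} {a b : G} {u : X →ₘ[μ] G} {v : Z →ₘ[ν] G}
    {hT : Measure.QuasiMeasurePreserving T μ μ} {hR : Measure.QuasiMeasurePreserving R ν ν}
    (hκ : IsJoining T^[p] μ R^[q] ν κ) (hu : IsPhase (koopman hT) (k + 1) (constHom μ a) u)
    (hv : IsPhase (koopman hR) (k + 1) (constHom ν b) v)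
    (hab : ¬IsOfFinOrder (b ^ q ^ (k + 1) / a ^ p ^ (k + 1))) :
    IsNontrivialPhase hκ.prodMap.quasiMeasurePreserving
      (pullback hκ.snd.quasiMeasurePreserving v / pullback hκ.fst.quasiMeasurePreserving u) := by
  refine ⟨k, _, hab, ?_⟩
  rw [map_div]
  have hfst : T^[p] ∘ Prod.fst = Prod.fst ∘ Prod.map T^[p] R^[q] := rfl
  have hsnd : R^[q] ∘ Prod.snd = Prod.snd ∘ Prod.map T^[p] R^[q] := rfl
  exact (hv.pullback_of_iterate _ _ hsnd).div (hu.pullback_of_iterate _ _ hfst)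

end Group

variable [IsFiniteMeasure μ] [IsFiniteMeasure ν]

theorem eventually_inner_circleToL2_eq_zero
    {hT : Measure.QuasiMeasurePreserving T μ μ} {hR : Measure.QuasiMeasurePreserving R ν ν}
    {u : X →ₘ[μ] Circle} {v : Z →ₘ[ν] Circle} (hu : IsNontrivialPhase hT u)
    (hv : IsNontrivialPhase hR v) :
    ∀ᶠ x in distinctPrimePairs, ∀ (κ : Measure (X × Z)) (hκ : IsJoining T^[x.1] μ R^[x.2] ν κ),
      inner ℂ (Lp.compMeasurePreservingₗᵢ ℂ Prod.fst hκ.fst (circleToL2 u))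
        (Lp.compMeasurePreservingₗᵢ ℂ Prod.snd hκ.snd (circleToL2 v)) = 0 := by
  obtain ⟨k, a, b, hab, hu, hv⟩ := hu.exists_common_degree hv
  filter_upwards [eventually_not_isOfFinOrder_pow_div_pow hab k.succ_ne_zero] with x hx κ hκ
  have : IsFiniteMeasure (κ.map Prod.fst) := hκ.fst.map_eq ▸ inferInstance
  have : IsFiniteMeasure κ := Measure.isFiniteMeasure_of_map hκ.fst.aemeasurable
  rw [compMeasurePreserving_circleToL2, compMeasurePreserving_circleToL2, ← inner_circleToL2_div]
  refine (hκ.isNontrivialPhase_div hu hv fun h => hx ?_).inner_circleToL2_one_eq_zero hκ.prodMap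
  simpa using h.inv

end IsJoining

/-- The joinings of iterates of `T` and `R`, with the two exponents. -/
def IterateJoining (T : X → X) (μ : Measure X) (R : Z → Z) (ν : Measure Z) : Type _ :=
  Σ x : ℕ × ℕ, {κ : Measure (X × Z) // IsJoining T^[x.1] μ R^[x.2] ν κ}

variable [IsFiniteMeasure μ] [IsFiniteMeasure ν]

theorem HasQuasiDiscreteSpectrum.eventually_norm_inner_joining_lt
    (hT : HasQuasiDiscreteSpectrum T μ) (hR : HasQuasiDiscreteSpectrum R ν)
    (hTμ : MeasurePreserving T μ μ) (hRν : MeasurePreserving R ν ν) {f : Lp ℂ 2 μ} {g : Lp ℂ 2 ν}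
    (hf : inner ℂ (circleToL2 1) f = 0) (hg : inner ℂ (circleToL2 1) g = 0) {ε : ℝ} (hε : 0 < ε) :
    ∀ᶠ x in distinctPrimePairs, ∀ (κ : Measure (X × Z)) (hκ : IsJoining T^[x.1] μ R^[x.2] ν κ),
      ‖inner ℂ (Lp.compMeasurePreservingₗᵢ ℂ Prod.fst hκ.fst f)
        (Lp.compMeasurePreservingₗᵢ ℂ Prod.snd hκ.snd g)‖ < ε := by
  have htendsto := tendsto_inner_zero_of_mem_closure_span₂
    (l := comap Sigma.fst distinctPrimePairs)
    (fun i : IterateJoining T μ R ν => Lp.compMeasurePreservingₗᵢ ℂ (E := ℂ) Prod.fst i.2.2.fst)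
    (fun i : IterateJoining T μ R ν => Lp.compMeasurePreservingₗᵢ ℂ (E := ℂ) Prod.snd i.2.2.snd)
    ?_ (hT.mem_closure_span_of_inner_one_eq_zero hTμ hf)
    (hR.mem_closure_span_of_inner_one_eq_zero hRν hg)
  · have hev := NormedAddGroup.tendsto_nhds_zero.mp htendsto ε hε
    rw [eventually_comap] at hev
    filter_upwards [hev] with x hx κ hκ
    exact hx ⟨x, κ, hκ⟩ rfl
  · rintro - ⟨u, hu, rfl⟩ - ⟨v, hv, rfl⟩
    refine tendsto_nhds_of_eventually_eq (eventually_comap.mpr ?_)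
    filter_upwards [IsJoining.eventually_inner_circleToL2_eq_zero hu hv]
    rintro - hx i rfl
    exact hx i.2.1 i.2.2

theorem HasQuasiDiscreteSpectrum.eventually_norm_integral_joining_lt
    (hT : HasQuasiDiscreteSpectrum T μ) (hTμ : MeasurePreserving T μ μ) {f : X → ℂ}
    (hf : MemLp f 2 μ) (hf0 : ∫ x, f x ∂μ = 0) {ε : ℝ} (hε : 0 < ε) :
    ∀ᶠ x in distinctPrimePairs, ∀ κ : Measure (X × X), IsJoining T^[x.1] μ T^[x.2] μ κ →
      ‖∫ z, f z.1 * (starRingEnd ℂ) (f z.2) ∂κ‖ < ε := by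
  have hfL : inner ℂ (circleToL2 1) hf.toLp = 0 := by
    rw [inner_circleToL2_one, integral_congr_ae hf.coeFn_toLp, hf0]
  filter_upwards [hT.eventually_norm_inner_joining_lt hT hTμ hTμ hfL hfL hε] with x hx κ hκ
  refine lt_of_eq_of_lt ?_ (hx κ hκ)
  rw [norm_inner_symm, L2.inner_def]
  refine congrArg norm (integral_congr_ae ?_)
  filter_upwards [Lp.coeFn_compMeasurePreserving hf.toLp hκ.fst,
    Lp.coeFn_compMeasurePreserving hf.toLp hκ.snd,
    hκ.fst.quasiMeasurePreserving.ae_eq_comp hf.coeFn_toLp,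
    hκ.snd.quasiMeasurePreserving.ae_eq_comp hf.coeFn_toLp] with z h₁ h₂ h₃ h₄
  have h₅ : Lp.compMeasurePreservingₗᵢ ℂ Prod.fst hκ.fst hf.toLp z = f z.1 := h₁.trans h₃
  have h₆ : Lp.compMeasurePreservingₗᵢ ℂ Prod.snd hκ.snd hf.toLp z = f z.2 := h₂.trans h₄
  rw [h₅, h₆]
  rfl

end Joinings

section OrbitAverage

variable {X : Type*} [MeasurableSpace X] {T : X → X} {μ : Measure X} {N : ℕ}

/-- The average of the first `N` images of `μ` under the iterates of `T`. For a Dirac measure this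
is the empirical measure of an orbit. -/
noncomputable def orbitAverage (T : X → X) (μ : Measure X) (N : ℕ) : Measure X :=
  (N : ENNReal)⁻¹ • ∑ n ∈ Finset.range N, μ.map T^[n]

theorem orbitAverage_apply (hT : Measurable T) {s : Set X} (hs : MeasurableSet s) :
    orbitAverage T μ N s = (N : ENNReal)⁻¹ * ∑ n ∈ Finset.range N, μ (T^[n] ⁻¹' s) := by
  simp only [orbitAverage, Measure.smul_apply, Measure.finsetSum_apply, smul_eq_mul,
    Measure.map_apply (hT.iterate _) hs]

theorem isProbabilityMeasure_orbitAverage [IsProbabilityMeasure μ] (hT : Measurable T)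
    (hN : N ≠ 0) : IsProbabilityMeasure (orbitAverage T μ N) := ⟨by
  rw [orbitAverage_apply hT .univ]
  simpa using ENNReal.inv_mul_cancel (Nat.cast_ne_zero.mpr hN) (ENNReal.natCast_ne_top N)⟩

theorem measurePreserving_orbitAverage (hT : Measurable T) (hμ : MeasurePreserving T^[N] μ μ) :
    MeasurePreserving T (orbitAverage T μ N) (orbitAverage T μ N) := by
  refine ⟨hT, Measure.ext fun s hs => ?_⟩
  have hsucc : ∀ n, T^[n] ⁻¹' (T ⁻¹' s) = T^[n + 1] ⁻¹' s := fun n => by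
    rw [← Set.preimage_comp, ← Function.iterate_succ']
  rw [Measure.map_apply hT hs, orbitAverage_apply hT hs, orbitAverage_apply hT (hT hs)]
  simp only [hsucc]
  cases N with
  | zero => simp
  | succ N =>
    rw [Finset.sum_range_succ, Finset.sum_range_succ' fun n => μ (T^[n] ⁻¹' s),
      hμ.measure_preimage hs.nullMeasurableSet, Function.iterate_zero, Set.preimage_id]

theorem absolutelyContinuous_orbitAverage (hT : Measurable T) (hN : N ≠ 0) :
    μ ≪ orbitAverage T μ N := by
  refine Measure.AbsolutelyContinuous.mk fun s hs h0 => ?_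
  rw [orbitAverage_apply hT hs, mul_eq_zero, Finset.sum_eq_zero_iff] at h0
  exact h0.resolve_left (ENNReal.inv_ne_zero.mpr (ENNReal.natCast_ne_top _)) 0
    (Finset.mem_range.mpr (Nat.pos_of_ne_zero hN))

theorem integral_orbitAverage_dirac [MeasurableSingletonClass X] {𝕜 : Type*} [RCLike 𝕜]
    (hT : Measurable T) (φ : X → 𝕜) (x : X) (N : ℕ) :
    ∫ z, φ z ∂orbitAverage T (Measure.dirac x) N = birkhoffAverage 𝕜 T φ N x := by
  have hmap : ∀ n, (Measure.dirac x).map T^[n] = Measure.dirac (T^[n] x) := fun n =>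
    Measure.map_dirac' (hT.iterate n) x
  simp only [orbitAverage, hmap]
  rw [integral_smul_measure, integral_finsetSum_measure fun i _ => integrable_dirac (by simp)]
  simp [birkhoffAverage, birkhoffSum, RCLike.real_smul_eq_coe_mul]

theorem IsUniquelyErgodic.eq_of_measurePreserving_iterate (hue : IsUniquelyErgodic T)
    (hT : Measurable T) {ν : Measure X} [IsProbabilityMeasure ν] (hν : MeasurePreserving T ν ν)
    {p : ℕ} (hp : p ≠ 0) (herg : Ergodic T^[p] ν) [IsProbabilityMeasure μ]
    (hμ : MeasurePreserving T^[p] μ μ) : μ = ν := by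
  have havg : orbitAverage T μ p = ν := hue.unique
    ⟨isProbabilityMeasure_orbitAverage hT hp, measurePreserving_orbitAverage hT hμ⟩
    ⟨inferInstance, hν⟩
  exact herg.eq_of_absolutelyContinuous hμ (havg ▸ absolutelyContinuous_orbitAverage hT hp)

end OrbitAverage

section KrylovBogolyubov

theorem birkhoffAverage_comp_self {𝕜 X M : Type*} [DivisionSemiring 𝕜] [AddCommMonoid M]
    [Module 𝕜 M] (T : X → X) (g : X → M) (n : ℕ) (x : X) :
    birkhoffAverage 𝕜 T (g ∘ T) n x = birkhoffAverage 𝕜 T g n (T x) := by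
  simp only [birkhoffAverage, birkhoffSum, Function.comp_apply, ← Function.iterate_succ_apply',
    ← Function.iterate_succ_apply]

variable {Z : Type*} [TopologicalSpace Z] [MeasurableSpace Z] [BorelSpace Z]
  [TopologicalSpace.MetrizableSpace Z] [CompactSpace Z] {R : Z → Z} {x : Z}
  {𝕜 : Type*} [RCLike 𝕜]

/-- The uniform probability measure on the first `N + 1` points of the orbit of `x`. -/
noncomputable def empiricalMeasure (hR : Measurable R) (x : Z) (N : ℕ) : ProbabilityMeasure Z :=
  ⟨orbitAverage R (Measure.dirac x) (N + 1), isProbabilityMeasure_orbitAverage hR N.succ_ne_zero⟩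

theorem tendsto_birkhoffAverage_of_tendsto_empiricalMeasure
    {hR : Measurable R} {l : Filter ℕ} {κ : ProbabilityMeasure Z}
    (h : Tendsto (empiricalMeasure hR x) l (𝓝 κ)) (φ : C(Z, 𝕜)) :
    Tendsto (fun N => birkhoffAverage 𝕜 R φ (N + 1) x) l (𝓝 (∫ z, φ z ∂κ)) := by
  have hint := (ProbabilityMeasure.tendsto_iff_forall_integral_rclike_tendsto 𝕜).mp h
    (BoundedContinuousFunction.mkOfCompact φ)
  exact hint.congr fun N => integral_orbitAverage_dirac hR φ x (N + 1)

theorem measurePreserving_of_tendsto_empiricalMeasure {hR : Measurable R} (hRc : Continuous R)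
    {l : Filter ℕ} [l.NeBot] (hl : l ≤ atTop) {κ : ProbabilityMeasure Z}
    (h : Tendsto (empiricalMeasure hR x) l (𝓝 κ)) : MeasurePreserving R (κ : Measure Z) κ := by
  refine ⟨hR, ?_⟩
  have := Measure.isProbabilityMeasure_map (μ := (κ : Measure Z)) hR.aemeasurable
  refine ext_of_forall_integral_eq_of_IsFiniteMeasure fun φ => ?_
  rw [integral_map hR.aemeasurable φ.continuous.aestronglyMeasurable]
  have hφ := tendsto_birkhoffAverage_of_tendsto_empiricalMeasure h φ.toContinuousMap
  have hφR := tendsto_birkhoffAverage_of_tendsto_empiricalMeasure h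
    (φ.toContinuousMap.comp ⟨R, hRc⟩)
  have hdiff := ((tendsto_birkhoffAverage_apply_sub_birkhoffAverage' ℝ φ.isBounded_range R x).comp
    (tendsto_add_atTop_nat 1)).mono_left hl
  refine sub_eq_zero.mp (tendsto_nhds_unique (hφR.sub hφ) (hdiff.congr fun N => ?_))
  exact congrArg (· - _) (birkhoffAverage_comp_self R φ (N + 1) x).symm

theorem eventually_norm_birkhoffAverage_lt (hR : Continuous R) (φ : C(Z, 𝕜)) (x : Z) {ε : ℝ}
    (hε : ∀ κ : Measure Z, IsProbabilityMeasure κ → MeasurePreserving R κ κ → ‖∫ z, φ z ∂κ‖ < ε) :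
    ∀ᶠ N in atTop, ‖birkhoffAverage 𝕜 R φ N x‖ < ε := by
  rw [← map_add_atTop_eq_nat 1, eventually_map]
  by_contra hfreq
  rw [not_eventually] at hfreq
  have := frequently_iff_neBot.mp hfreq
  have hU := Ultrafilter.of_le (atTop ⊓ 𝓟 {N | ¬‖birkhoffAverage 𝕜 R φ (N + 1) x‖ < ε})
  set U := Ultrafilter.of (atTop ⊓ 𝓟 {N | ¬‖birkhoffAverage 𝕜 R φ (N + 1) x‖ < ε})
  obtain ⟨κ, -, hκ⟩ := isCompact_univ.ultrafilter_le_nhds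
    (U.map (empiricalMeasure hR.measurable x)) (by simp)
  have hlim := (tendsto_birkhoffAverage_of_tendsto_empiricalMeasure hκ φ).norm
  have hinv := measurePreserving_of_tendsto_empiricalMeasure hR (hU.trans inf_le_left) hκ
  refine (hε κ inferInstance hinv).not_ge (ge_of_tendsto hlim ?_)
  filter_upwards [hU.trans inf_le_right (mem_principal_self _)] with N hN
  exact not_lt.mp hN

end KrylovBogolyubov

section Correlations

theorem IsUniquelyErgodic.isJoining {Y : Type*} [MeasurableSpace Y] {S : Y → Y} {ν : Measure Y}
    [IsProbabilityMeasure ν] (hue : IsUniquelyErgodic S) (hν : MeasurePreserving S ν ν)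
    (hS : IsTotallyErgodic S ν) {p q : ℕ} (hp : p ≠ 0) (hq : q ≠ 0) {κ : Measure (Y × Y)}
    [IsProbabilityMeasure κ] (hκ : MeasurePreserving (Prod.map S^[p] S^[q]) κ κ) :
    IsJoining S^[p] ν S^[q] ν κ := by
  have hfactor : ∀ {π : Y × Y → Y} {r : ℕ}, Measurable π → r ≠ 0 →
      Function.Semiconj π (Prod.map S^[p] S^[q]) S^[r] → MeasurePreserving π κ ν := by
    intro π r hπ hr hcomm
    have hprob := Measure.isProbabilityMeasure_map (μ := κ) hπ.aemeasurable
    have hinv := (hπ.measurePreserving κ).of_semiconj hκ hcomm (hν.measurable.iterate r)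
    exact ⟨hπ, hue.eq_of_measurePreserving_iterate hν.measurable hν hr (hS r hr) hinv⟩
  exact ⟨hκ, hfactor measurable_fst hp fun _ => rfl,
    hfactor measurable_snd hq fun _ => rfl⟩

theorem birkhoffSum_apply_self {X M : Type*} [AddCommMonoid M] (T : X → X) (g : X → M) (N : ℕ)
    (x : X) : birkhoffSum T g N (T x) = ∑ n ∈ Finset.Icc 1 N, g (T^[n] x) := by
  rw [← Finset.Ico_add_one_right_eq_Icc, ← zero_add 1, ← Finset.sum_Ico_add', birkhoffSum,
    Finset.range_eq_Ico]
  rfl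

variable {Y : Type*} [TopologicalSpace Y] [TopologicalSpace.MetrizableSpace Y]
  [CompactSpace Y] [MeasurableSpace Y] [BorelSpace Y] {S : Y → Y} {ν : Measure Y}
  [IsProbabilityMeasure ν]

theorem HasQuasiDiscreteSpectrum.eventually_norm_sum_mul_conj_le
    (hqds : HasQuasiDiscreteSpectrum S ν) (hue : IsUniquelyErgodic S)
    (hν : MeasurePreserving S ν ν) (hS : Continuous S) (f : C(Y, ℂ)) (hf : ∫ x, f x ∂ν = 0)
    (y : Y) {ε : ℝ} (hε : 0 < ε) :
    ∀ᶠ x in distinctPrimePairs, ∀ᶠ N : ℕ in atTop,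
      ‖∑ n ∈ Finset.Icc 1 N, f (S^[x.1 * n] y) * (starRingEnd ℂ) (f (S^[x.2 * n] y))‖ ≤ ε * N := by
  have hfL : MemLp f 2 ν := .of_bound f.continuous.aestronglyMeasurable ‖f‖
    (.of_forall f.norm_coe_le_norm)
  filter_upwards [hqds.eventually_norm_integral_joining_lt hν hfL hf hε,
    eventually_distinctPrimePairs_prime] with ⟨p, q⟩ hjoin ⟨hp, hq, _⟩
  let φ : C(Y × Y, ℂ) := ⟨fun z => f z.1 * (starRingEnd ℂ) (f z.2), by fun_prop⟩
  have hR : Continuous (Prod.map S^[p] S^[q]) := (hS.iterate p).prodMap (hS.iterate q)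
  filter_upwards [eventually_norm_birkhoffAverage_lt hR φ (Prod.map S^[p] S^[q] (y, y))
    fun κ _ hκ => hjoin κ (hue.isJoining hν hqds.totallyErgodic hp.ne_zero hq.ne_zero hκ)] with N hN
  rcases N.eq_zero_or_pos with rfl | hN0
  · simp
  rw [birkhoffAverage, birkhoffSum_apply_self, norm_smul, norm_inv, RCLike.norm_natCast,
    inv_mul_lt_iff₀ (by positivity), mul_comm] at hN
  simp only [Prod.map_iterate, Prod.map_apply, ← Function.iterate_mul] at hN
  exact hN.le

end Correlations

section TuranKubilius

open Finset (Icc)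

theorem sum_Icc_filter_dvd {M : Type*} [AddCommMonoid M] (g : ℕ → M) {p : ℕ} (hp : 0 < p)
    (N : ℕ) : ∑ n ∈ Icc 1 N with p ∣ n, g n = ∑ m ∈ Icc 1 (N / p), g (p * m) := by
  refine (Finset.sum_nbij (p * ·) (fun m hm => ?_) (fun a _ b _ h => ?_) (fun n hn => ?_)
    fun _ _ => rfl).symm
  · rw [Finset.mem_Icc, Nat.le_div_iff_mul_le hp, mul_comm] at hm
    simp only [Finset.mem_filter, Finset.mem_Icc]
    exact ⟨⟨Nat.mul_pos hp hm.1, hm.2⟩, dvd_mul_right p m⟩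
  · exact Nat.eq_of_mul_eq_mul_left hp h
  · simp only [Finset.coe_filter, Set.mem_ofPred_eq, Finset.mem_Icc] at hn
    obtain ⟨⟨hn1, hnN⟩, m, rfl⟩ := hn
    exact ⟨m, Finset.mem_coe.2 (Finset.mem_Icc.2
      ⟨Nat.pos_of_mul_pos_left hn1, (Nat.le_div_iff_mul_le hp).2 (mul_comm m p ▸ hnN)⟩), rfl⟩

theorem card_Icc_filter_dvd (d N : ℕ) : {n ∈ Icc 1 N | d ∣ n}.card = N / d :=
  Nat.Ioc_filter_dvd_card_eq_div N d

/-- The number of elements of `P` dividing `n`; for a set `P` of primes this is the truncation to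
`P` of the number of prime divisors `ω(n)`. -/
def divisorCount (P : Finset ℕ) (n : ℕ) : ℕ := {p ∈ P | p ∣ n}.card

theorem sum_divisorCount (P : Finset ℕ) (N : ℕ) :
    ∑ n ∈ Icc 1 N, divisorCount P n = ∑ p ∈ P, N / p := by
  simpa only [Finset.bipartiteAbove, Finset.bipartiteBelow, card_Icc_filter_dvd, divisorCount] using
    Finset.sum_card_bipartiteAbove_eq_sum_card_bipartiteBelow (s := Icc 1 N) (t := P)
      fun n p => p ∣ n

theorem sum_divisorCount_sq (P : Finset ℕ) (N : ℕ) :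
    ∑ n ∈ Icc 1 N, divisorCount P n ^ 2 = ∑ p ∈ P, ∑ q ∈ P, N / p.lcm q := by
  have hsq : ∀ n, divisorCount P n ^ 2 = {x ∈ P ×ˢ P | x.1 ∣ n ∧ x.2 ∣ n}.card := fun n => by
    rw [Finset.filter_product (· ∣ n) (· ∣ n), Finset.card_product, sq, divisorCount]
  simpa only [Finset.bipartiteAbove, Finset.bipartiteBelow, hsq, Finset.sum_product,
    ← Nat.lcm_dvd_iff, card_Icc_filter_dvd] using
    Finset.sum_card_bipartiteAbove_eq_sum_card_bipartiteBelow (s := Icc 1 N) (t := P ×ˢ P)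
      fun n x => x.1 ∣ n ∧ x.2 ∣ n

theorem mul_sum_inv_sub_card_le_sum_divisorCount (P : Finset ℕ) (N : ℕ) :
    N * ∑ p ∈ P, (p : ℝ)⁻¹ - P.card ≤ ∑ n ∈ Icc 1 N, (divisorCount P n : ℝ) := by
  rw [← Nat.cast_sum, sum_divisorCount, Nat.cast_sum, Finset.mul_sum, Finset.card_eq_sum_ones,
    Nat.cast_sum, Nat.cast_one, ← Finset.sum_sub_distrib]
  refine Finset.sum_le_sum fun p _ => ?_
  rw [← div_eq_mul_inv, ← Nat.floor_div_eq_div (K := ℝ)]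
  exact (Nat.sub_one_lt_floor _).le

theorem sum_divisorCount_sq_le {P : Finset ℕ} (hP : (P : Set ℕ).Pairwise Nat.Coprime) (N : ℕ) :
    ∑ n ∈ Icc 1 N, (divisorCount P n : ℝ) ^ 2 ≤
      N * (∑ p ∈ P, (p : ℝ)⁻¹) ^ 2 + N * ∑ p ∈ P, (p : ℝ)⁻¹ := by
  have hpair : ∀ p ∈ P, ∀ q ∈ P, ((N / p.lcm q : ℕ) : ℝ) ≤
      N * ((p : ℝ)⁻¹ * (q : ℝ)⁻¹) + if p = q then N * (p : ℝ)⁻¹ else 0 := by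
    intro p hp q hq
    refine Nat.cast_div_le.trans ?_
    split_ifs with hpq
    · rw [← hpq, Nat.lcm_self, div_eq_mul_inv]
      exact le_add_of_nonneg_left (by positivity)
    · rw [(hP hp hq hpq).lcm_eq_mul, Nat.cast_mul, div_eq_mul_inv, mul_inv, add_zero]
  calc ∑ n ∈ Icc 1 N, (divisorCount P n : ℝ) ^ 2
      = ∑ p ∈ P, ∑ q ∈ P, ((N / p.lcm q : ℕ) : ℝ) := by
        exact_mod_cast congrArg (Nat.cast (R := ℝ)) (sum_divisorCount_sq P N)
    _ ≤ ∑ p ∈ P, ∑ q ∈ P, (N * ((p : ℝ)⁻¹ * (q : ℝ)⁻¹) + if p = q then N * (p : ℝ)⁻¹ else 0) :=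
        Finset.sum_le_sum fun p hp => Finset.sum_le_sum fun q hq => hpair p hp q hq
    _ = N * (∑ p ∈ P, (p : ℝ)⁻¹) ^ 2 + N * ∑ p ∈ P, (p : ℝ)⁻¹ := by
        rw [sq, Finset.sum_mul_sum]
        simp only [Finset.sum_add_distrib, Finset.mul_sum, Finset.sum_ite_eq, Finset.sum_ite_mem,
          Finset.inter_self]

/-- The **Turán–Kubilius inequality** for a finite set of pairwise coprime integers. -/
theorem sum_divisorCount_sub_sq_le {P : Finset ℕ} (hP : (P : Set ℕ).Pairwise Nat.Coprime)
    (N : ℕ) : ∑ n ∈ Icc 1 N, (divisorCount P n - ∑ p ∈ P, (p : ℝ)⁻¹) ^ 2 ≤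
      (N + 2 * P.card) * ∑ p ∈ P, (p : ℝ)⁻¹ := by
  have hfirst := mul_sum_inv_sub_card_le_sum_divisorCount P N
  have hsecond := sum_divisorCount_sq_le hP N
  set A := ∑ p ∈ P, (p : ℝ)⁻¹
  have hA : 0 ≤ A := Finset.sum_nonneg fun p _ => by positivity
  have hexpand : ∑ n ∈ Icc 1 N, (divisorCount P n - A) ^ 2 = ∑ n ∈ Icc 1 N,
      (divisorCount P n : ℝ) ^ 2 - 2 * A * ∑ n ∈ Icc 1 N, (divisorCount P n : ℝ) + N * A ^ 2 := by
    simp only [sub_sq, Finset.sum_add_distrib, Finset.sum_sub_distrib, Finset.mul_sum,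
      Finset.sum_const, Nat.card_Icc, add_tsub_cancel_right, nsmul_eq_mul]
    simp only [mul_assoc, mul_comm A]
  nlinarith

theorem sum_abs_divisorCount_sub_le {P : Finset ℕ} (hP : (P : Set ℕ).Pairwise Nat.Coprime)
    {N : ℕ} (hN : 2 * P.card ≤ N) :
    ∑ n ∈ Icc 1 N, |divisorCount P n - ∑ p ∈ P, (p : ℝ)⁻¹| ≤
      N * √(2 * ∑ p ∈ P, (p : ℝ)⁻¹) := by
  have hTK := sum_divisorCount_sub_sq_le hP N
  set A := ∑ p ∈ P, (p : ℝ)⁻¹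
  have hA : 0 ≤ A := Finset.sum_nonneg fun p _ => by positivity
  have hN' : 2 * (P.card : ℝ) ≤ N := by exact_mod_cast hN
  refine (abs_le_of_sq_le_sq' (sq_sum_le_card_mul_sum_sq.trans ?_) (by positivity)).2
  simp only [sq_abs, Nat.card_Icc, add_tsub_cancel_right]
  rw [mul_pow, Real.sq_sqrt (by positivity), sq, mul_assoc]
  gcongr
  exact hTK.trans (by nlinarith)

theorem sum_divisorCount_mul {P : Finset ℕ} (hP : ∀ p ∈ P, 0 < p) (a : ℕ → ℂ) (N : ℕ) :
    ∑ n ∈ Icc 1 N, (divisorCount P n : ℂ) * a n =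
      ∑ p ∈ P, ∑ m ∈ Icc 1 (N / p), a (p * m) := by
  rw [← Finset.sum_congr rfl fun p hp => sum_Icc_filter_dvd a (hP p hp) N]
  simp only [divisorCount, Finset.card_filter, Nat.cast_sum, Finset.sum_mul, Finset.sum_filter]
  rw [Finset.sum_comm]
  simp

theorem norm_sum_inv_mul_sum_sub_le {P : Finset ℕ} (hP : (P : Set ℕ).Pairwise Nat.Coprime)
    (hP0 : ∀ p ∈ P, 0 < p) {a : ℕ → ℂ} (ha : ∀ n, ‖a n‖ ≤ 1) {N : ℕ} (hN : 2 * P.card ≤ N) :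
    ‖((∑ p ∈ P, (p : ℝ)⁻¹ : ℝ) : ℂ) * ∑ n ∈ Icc 1 N, a n -
      ∑ p ∈ P, ∑ m ∈ Icc 1 (N / p), a (p * m)‖ ≤ N * √(2 * ∑ p ∈ P, (p : ℝ)⁻¹) := by
  refine le_trans ?_ (sum_abs_divisorCount_sub_le hP hN)
  rw [← sum_divisorCount_mul hP0, Finset.mul_sum, ← Finset.sum_sub_distrib]
  refine norm_sum_le_of_le _ fun n _ => ?_
  rw [← sub_mul, norm_mul, ← Complex.ofReal_natCast, ← Complex.ofReal_sub, Complex.norm_real,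
    norm_sub_rev, Real.norm_eq_abs]
  exact mul_le_of_le_one_right (abs_nonneg _) (ha n)

end TuranKubilius

section BilinearSums

open Finset (Icc)

theorem sum_norm_sum_sq_le {ι κ : Type*} (P : Finset ι) (s : Finset κ) (w : ι → κ → ℂ)
    {X η : ℝ} (hη : 0 ≤ η) (hdiag : ∀ p ∈ P, ∑ m ∈ s, ‖w p m‖ ^ 2 ≤ X)
    (hoff : ∀ p ∈ P, ∀ q ∈ P, p ≠ q → ‖∑ m ∈ s, w p m * starRingEnd ℂ (w q m)‖ ≤ η) :
    ∑ m ∈ s, ‖∑ p ∈ P, w p m‖ ^ 2 ≤ P.card * X + P.card ^ 2 * η := by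
  classical
  have hexpand : ((∑ m ∈ s, ‖∑ p ∈ P, w p m‖ ^ 2 : ℝ) : ℂ) =
      ∑ p ∈ P, ∑ q ∈ P, ∑ m ∈ s, w p m * starRingEnd ℂ (w q m) := by
    simp only [Complex.ofReal_sum, Complex.ofReal_pow, ← Complex.mul_conj', map_sum,
      Finset.sum_mul_sum]
    rw [Finset.sum_comm, Finset.sum_congr rfl fun p _ => Finset.sum_comm]
  have hpair : ∀ p ∈ P, ∀ q ∈ P, ‖∑ m ∈ s, w p m * starRingEnd ℂ (w q m)‖ ≤
      (if p = q then X else 0) + η := by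
    intro p hp q hq
    split_ifs with hpq
    · subst hpq
      refine le_add_of_le_of_nonneg ((norm_sum_le _ _).trans ?_) hη
      simpa only [norm_mul, RCLike.norm_conj, ← sq] using hdiag p hp
    · simpa only [zero_add] using hoff p hp q hq hpq
  calc ∑ m ∈ s, ‖∑ p ∈ P, w p m‖ ^ 2
      ≤ ‖((∑ m ∈ s, ‖∑ p ∈ P, w p m‖ ^ 2 : ℝ) : ℂ)‖ := by
        rw [Complex.norm_real]
        exact Real.le_norm_self _
    _ ≤ ∑ p ∈ P, ∑ q ∈ P, ((if p = q then X else 0) + η) := by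
        rw [hexpand]
        exact norm_sum_le_of_le _ fun p hp => norm_sum_le_of_le _ fun q hq => hpair p hp q hq
    _ = P.card * X + P.card ^ 2 * η := by
        simp only [Finset.sum_add_distrib, Finset.sum_ite_eq, Finset.sum_ite_mem,
          Finset.inter_self, Finset.sum_const, nsmul_eq_mul]
        ring

theorem norm_sum_mul_sum_le {ι κ : Type*} (P : Finset ι) (s : Finset κ) {u : κ → ℂ}
    (w : ι → κ → ℂ) {X δ : ℝ} (hX : (s.card : ℝ) ≤ X) (hδ : 0 < δ) (hu : ∀ m, ‖u m‖ ≤ 1)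
    (hw : ∀ p m, ‖w p m‖ ≤ 1)
    (hcor : ∀ p ∈ P, ∀ q ∈ P, p ≠ q → ‖∑ m ∈ s, w p m * starRingEnd ℂ (w q m)‖ ≤ δ ^ 2 * X) :
    ‖∑ m ∈ s, u m * ∑ p ∈ P, w p m‖ ≤ X * (δ * P.card + 1 / (2 * δ)) := by
  have hX0 : 0 ≤ X := (Nat.cast_nonneg _).trans hX
  have hdiag : ∀ p ∈ P, ∑ m ∈ s, ‖w p m‖ ^ 2 ≤ X := fun p _ => by
    refine (Finset.sum_le_card_nsmul s _ 1 fun m _ => pow_le_one₀ (norm_nonneg _) (hw p m)).trans ?_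
    rwa [nsmul_one]
  have hL2 := sum_norm_sum_sq_le P s w (by positivity) hdiag hcor
  have hL1 : (∑ m ∈ s, ‖∑ p ∈ P, w p m‖) ^ 2 ≤ (X * (δ * P.card + 1 / (2 * δ))) ^ 2 :=
    calc (∑ m ∈ s, ‖∑ p ∈ P, w p m‖) ^ 2
        ≤ s.card * ∑ m ∈ s, ‖∑ p ∈ P, w p m‖ ^ 2 := sq_sum_le_card_mul_sum_sq
      _ ≤ X * (P.card * X + P.card ^ 2 * (δ ^ 2 * X)) := by gcongr
      _ ≤ X * (P.card * X + P.card ^ 2 * (δ ^ 2 * X)) + (X * (1 / (2 * δ))) ^ 2 :=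
          le_add_of_nonneg_right (by positivity)
      _ = (X * (δ * P.card + 1 / (2 * δ))) ^ 2 := by
          field_simp
          ring
  refine le_trans ?_ (abs_le_of_sq_le_sq' hL1 (by positivity)).2
  refine norm_sum_le_of_le s fun m _ => ?_
  rw [norm_mul]
  exact mul_le_of_le_one_left (norm_nonneg _) (hu m)

theorem sum_Icc_ite_le {M : Type*} [AddCommMonoid M] (g : ℕ → M) {k n : ℕ} (h : k ≤ n) :
    ∑ m ∈ Icc 1 n, (if m ≤ k then g m else 0) = ∑ m ∈ Icc 1 k, g m := by
  rw [← Finset.sum_filter]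
  congr 1
  ext m
  simp only [Finset.mem_filter, Finset.mem_Icc]
  lia

variable {u F : ℕ → ℂ} {P : Finset ℕ} {N : ℕ} {δ : ℝ}

theorem norm_sum_sum_mul_le_of_le (hu : ∀ n, ‖u n‖ ≤ 1) (hF : ∀ n, ‖F n‖ ≤ 1) {B : ℕ}
    (hB : 0 < B) (hP : ∀ p ∈ P, B ≤ p) (hδ : 0 < δ)
    (hcor : ∀ p ∈ P, ∀ q ∈ P, p ≠ q →
      ‖∑ m ∈ Icc 1 (min (N / p) (N / q)), F (p * m) * starRingEnd ℂ (F (q * m))‖ ≤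
        δ ^ 2 * (min (N / p) (N / q) : ℕ)) :
    ‖∑ p ∈ P, ∑ m ∈ Icc 1 (N / p), F (p * m) * (u p * u m)‖ ≤
      N / B * (δ * P.card + 1 / (2 * δ)) := by
  have hdiv : ∀ p ∈ P, N / p ≤ N / B := fun p hp => Nat.div_le_div_left (hP p hp) hB
  have hdiv_cast : ((N / B : ℕ) : ℝ) ≤ N / B := Nat.cast_div_le
  let w : ℕ → ℕ → ℂ := fun p m => if m ≤ N / p then F (p * m) * u p else 0
  have hw : ∀ p m, ‖w p m‖ ≤ 1 := fun p m => by
    simp only [w]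
    split_ifs
    · exact norm_mul_le_of_le (hF _) (hu _) |>.trans_eq (one_mul 1)
    · simp
  have hswap : ∑ p ∈ P, ∑ m ∈ Icc 1 (N / p), F (p * m) * (u p * u m) =
      ∑ m ∈ Icc 1 (N / B), u m * ∑ p ∈ P, w p m := by
    simp only [Finset.mul_sum]
    rw [Finset.sum_comm]
    refine Finset.sum_congr rfl fun p hp => ?_
    rw [← sum_Icc_ite_le _ (hdiv p hp)]
    refine Finset.sum_congr rfl fun m _ => ?_
    rw [mul_ite, mul_zero, mul_comm (u m), mul_assoc]
  rw [hswap]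
  refine norm_sum_mul_sum_le P _ w (by simpa using hdiv_cast) hδ hu hw fun p hp q hq hpq => ?_
  have htrunc : ∀ m, w p m * starRingEnd ℂ (w q m) = if m ≤ min (N / p) (N / q) then
      (u p * starRingEnd ℂ (u q)) * (F (p * m) * starRingEnd ℂ (F (q * m))) else 0 := fun m => by
    simp only [w, le_min_iff, ite_and, apply_ite (starRingEnd ℂ), map_mul, map_zero, mul_ite,
      ite_mul, mul_zero, zero_mul]
    split_ifs <;> ring
  have hmin := (min_le_left (N / p) (N / q)).trans (hdiv p hp)
  simp only [htrunc]
  rw [sum_Icc_ite_le _ hmin, ← Finset.mul_sum]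
  refine (norm_mul_le_of_le (norm_mul_le_of_le (hu p) ((RCLike.norm_conj (u q)).trans_le (hu q)))
    (hcor p hp q hq hpq)).trans ?_
  rw [one_mul, one_mul]
  gcongr
  exact (Nat.cast_le.2 hmin).trans hdiv_cast

theorem sum_card_log_fiber_div_le (hP : ∀ p ∈ P, p ≠ 0) :
    ∑ j ∈ P.image (Nat.log 2), ({p ∈ P | Nat.log 2 p = j}.card : ℝ) / 2 ^ j ≤
      2 * ∑ p ∈ P, (p : ℝ)⁻¹ := by
  rw [← Finset.sum_fiberwise_of_maps_to (fun p hp => Finset.mem_image_of_mem (Nat.log 2) hp)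
    fun p => (p : ℝ)⁻¹, Finset.mul_sum]
  refine Finset.sum_le_sum fun j _ => ?_
  rw [Finset.card_eq_sum_ones, Nat.cast_sum, Finset.sum_div, Finset.mul_sum]
  refine Finset.sum_le_sum fun p hp => ?_
  obtain ⟨hpP, rfl⟩ := Finset.mem_filter.mp hp
  have hp0 : (0 : ℝ) < p := by exact_mod_cast Nat.pos_of_ne_zero (hP p hpP)
  have hlog : (p : ℝ) ≤ 2 ^ Nat.log 2 p * 2 := by
    exact_mod_cast (Nat.lt_pow_succ_log_self one_lt_two p).le
  rw [Nat.cast_one, ← div_eq_mul_inv, div_le_div_iff₀ (by positivity) hp0]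
  linarith

theorem sum_one_div_two_pow_le (s : Finset ℕ) : ∑ j ∈ s, (1 : ℝ) / 2 ^ j ≤ 2 := by
  simpa only [one_div_pow] using
    (summable_geometric_two.sum_le_tsum s fun _ _ => by positivity).trans_eq tsum_geometric_two

/- Cutting `P` into dyadic blocks makes the ranges `m ≤ N / p` comparable within a block, so that
Cauchy–Schwarz in `m` costs only a constant factor. -/
theorem norm_sum_sum_mul_le (hu : ∀ n, ‖u n‖ ≤ 1) (hF : ∀ n, ‖F n‖ ≤ 1) (hP : ∀ p ∈ P, p ≠ 0)
    (hδ : 0 < δ)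
    (hcor : ∀ p ∈ P, ∀ q ∈ P, p ≠ q →
      ‖∑ m ∈ Icc 1 (min (N / p) (N / q)), F (p * m) * starRingEnd ℂ (F (q * m))‖ ≤
        δ ^ 2 * (min (N / p) (N / q) : ℕ)) :
    ‖∑ p ∈ P, ∑ m ∈ Icc 1 (N / p), F (p * m) * (u p * u m)‖ ≤
      N * (2 * δ * ∑ p ∈ P, (p : ℝ)⁻¹ + 1 / δ) := by
  set J := P.image (Nat.log 2)
  have hblock : ∀ j ∈ J, ‖∑ p ∈ P with Nat.log 2 p = j,
      ∑ m ∈ Icc 1 (N / p), F (p * m) * (u p * u m)‖ ≤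
        N / (2 ^ j : ℕ) * (δ * {p ∈ P | Nat.log 2 p = j}.card + 1 / (2 * δ)) := fun j _ => by
    refine norm_sum_sum_mul_le_of_le hu hF (by positivity) (fun p hp => ?_) hδ fun p hp q hq =>
      hcor p (Finset.mem_filter.mp hp).1 q (Finset.mem_filter.mp hq).1
    obtain ⟨hpP, rfl⟩ := Finset.mem_filter.mp hp
    exact Nat.pow_log_le_self 2 (hP p hpP)
  rw [← Finset.sum_fiberwise_of_maps_to (fun p hp => Finset.mem_image_of_mem (Nat.log 2) hp)
    fun p => ∑ m ∈ Icc 1 (N / p), F (p * m) * (u p * u m)]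
  calc _ ≤ ∑ j ∈ J, (N / (2 ^ j : ℕ) * (δ * {p ∈ P | Nat.log 2 p = j}.card + 1 / (2 * δ)) : ℝ) :=
        norm_sum_le_of_le _ hblock
    _ = N * (δ * ∑ j ∈ J, ({p ∈ P | Nat.log 2 p = j}.card : ℝ) / 2 ^ j
        + 1 / (2 * δ) * ∑ j ∈ J, (1 : ℝ) / 2 ^ j) := by
        rw [Finset.mul_sum, Finset.mul_sum, ← Finset.sum_add_distrib, Finset.mul_sum]
        refine Finset.sum_congr rfl fun j _ => ?_
        push_cast
        ring
    _ ≤ N * (δ * (2 * ∑ p ∈ P, (p : ℝ)⁻¹) + 1 / (2 * δ) * 2) := by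
        gcongr
        · exact sum_card_log_fiber_div_le hP
        · exact sum_one_div_two_pow_le J
    _ = _ := by field_simp

end BilinearSums

section OrthogonalityCriterion

open Finset (Icc)

variable {u : ArithmeticFunction ℂ} {F : ℕ → ℂ} {P : Finset ℕ} {N : ℕ} {δ : ℝ}

theorem exists_finset_primes_le_sum_inv (K : ℕ) (B : ℝ) :
    ∃ P : Finset ℕ, (∀ p ∈ P, p.Prime ∧ K ≤ p) ∧ B ≤ ∑ p ∈ P, (p : ℝ)⁻¹ := by
  by_contra! hcon
  refine not_summable_one_div_on_primes ((summable_nat_add_iff K).1 ?_)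
  refine summable_of_sum_le (c := B) (fun n => Set.indicator_nonneg (fun _ _ => by positivity) _)
    fun s => ?_
  have h := hcon ((s.map (addRightEmbedding K)).filter Nat.Prime) fun p hp => by
    obtain ⟨hps, hp⟩ := Finset.mem_filter.1 hp
    obtain ⟨a, -, rfl⟩ := Finset.mem_map.1 hps
    exact ⟨hp, Nat.le_add_left K a⟩
  rw [Finset.sum_filter, Finset.sum_map] at h
  refine le_of_eq_of_le (Finset.sum_congr rfl fun n _ => ?_) h.le
  simp [Set.indicator_apply]

theorem norm_sum_mul_sub_le_of_prime (hmul : u.IsMultiplicative) (hu : ∀ n, ‖u n‖ ≤ 1)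
    (hF : ∀ n, ‖F n‖ ≤ 1) {p : ℕ} (hp : p.Prime) (N : ℕ) :
    ‖∑ m ∈ Icc 1 (N / p), F (p * m) * u (p * m) -
      ∑ m ∈ Icc 1 (N / p), F (p * m) * (u p * u m)‖ ≤ N * (2 * (p : ℝ)⁻¹ * (p : ℝ)⁻¹) := by
  have hterm : ∀ m, ‖F (p * m) * u (p * m) - F (p * m) * (u p * u m)‖ ≤
      2 * if p ∣ m then 1 else 0 := fun m => by
    split_ifs with hpm
    · have h1 : ‖u p * u m‖ ≤ 1 * 1 := norm_mul_le_of_le (hu p) (hu m)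
      rw [← mul_sub]
      refine (norm_mul_le_of_le (hF _) ((norm_sub_le_of_le (hu _) h1))).trans_eq ?_
      norm_num
    · rw [hmul.map_mul_of_coprime ((Nat.Prime.coprime_iff_not_dvd hp).2 hpm)]
      simp
  rw [← Finset.sum_sub_distrib]
  calc _ ≤ ∑ m ∈ Icc 1 (N / p), 2 * (if p ∣ m then 1 else 0 : ℝ) :=
        norm_sum_le_of_le _ fun m _ => hterm m
    _ = 2 * (N / p / p : ℕ) := by
        rw [← Finset.mul_sum, Finset.sum_boole, card_Icc_filter_dvd]
    _ ≤ 2 * (N / p / p) := by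
        gcongr
        refine Nat.cast_div_le.trans ?_
        gcongr
        exact Nat.cast_div_le
    _ = N * (2 * (p : ℝ)⁻¹ * (p : ℝ)⁻¹) := by
        field_simp

theorem sum_inv_mul_norm_sum_le (hmul : u.IsMultiplicative) (hu : ∀ n, ‖u n‖ ≤ 1)
    (hF : ∀ n, ‖F n‖ ≤ 1) (hP : ∀ p ∈ P, p.Prime) (hPδ : ∀ p ∈ P, (p : ℝ)⁻¹ ≤ δ) (hδ : 0 < δ)
    (hN : 2 * P.card ≤ N)
    (hcor : ∀ p ∈ P, ∀ q ∈ P, p ≠ q →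
      ‖∑ m ∈ Icc 1 (min (N / p) (N / q)), F (p * m) * starRingEnd ℂ (F (q * m))‖ ≤
        δ ^ 2 * (min (N / p) (N / q) : ℕ)) :
    (∑ p ∈ P, (p : ℝ)⁻¹) * ‖∑ n ∈ Icc 1 N, F n * u n‖ ≤
      N * (√(2 * ∑ p ∈ P, (p : ℝ)⁻¹) + 4 * δ * ∑ p ∈ P, (p : ℝ)⁻¹ + 1 / δ) := by
  have hcoprime : (P : Set ℕ).Pairwise Nat.Coprime := fun p hp q hq hpq =>
    (Nat.coprime_primes (hP p hp) (hP q hq)).2 hpq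
  have hdual := norm_sum_inv_mul_sum_sub_le hcoprime (fun p hp => (hP p hp).pos)
    (a := fun n => F n * u n)
    (fun n => (norm_mul_le_of_le (hF n) (hu n)).trans_eq (one_mul 1)) hN
  have hmult : ‖∑ p ∈ P, ∑ m ∈ Icc 1 (N / p), F (p * m) * u (p * m) -
      ∑ p ∈ P, ∑ m ∈ Icc 1 (N / p), F (p * m) * (u p * u m)‖ ≤
        N * (2 * δ * ∑ p ∈ P, (p : ℝ)⁻¹) := by
    simp only [← Finset.sum_sub_distrib, Finset.mul_sum]
    refine norm_sum_le_of_le _ fun p hp => ?_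
    rw [Finset.sum_sub_distrib]
    refine (norm_sum_mul_sub_le_of_prime hmul hu hF (hP p hp) N).trans ?_
    gcongr
    exact hPδ p hp
  have hbilinear := norm_sum_sum_mul_le hu hF (fun p hp => (hP p hp).ne_zero) hδ hcor
  set A := ∑ p ∈ P, (p : ℝ)⁻¹
  set T := ∑ p ∈ P, ∑ m ∈ Icc 1 (N / p), F (p * m) * u (p * m)
  set B := ∑ p ∈ P, ∑ m ∈ Icc 1 (N / p), F (p * m) * (u p * u m)
  have hA : 0 ≤ A := Finset.sum_nonneg fun p _ => by positivity
  calc A * ‖∑ n ∈ Icc 1 N, F n * u n‖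
      = ‖(A * ∑ n ∈ Icc 1 N, F n * u n - T) + (T - B) + B‖ := by
        rw [sub_add_sub_cancel, sub_add_cancel, norm_mul, Complex.norm_real,
          Real.norm_of_nonneg hA]
    _ ≤ N * √(2 * A) + N * (2 * δ * A) + N * (2 * δ * A + 1 / δ) :=
        norm_add₃_le.trans (add_le_add_three hdual hmult hbilinear)
    _ = N * (√(2 * A) + 4 * δ * A + 1 / δ) := by ring

theorem eventually_norm_sum_mul_le (hmul : u.IsMultiplicative) (hu : ∀ n, ‖u n‖ ≤ 1)
    (hF : ∀ n, ‖F n‖ ≤ 1)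
    (hcor : ∀ ε : ℝ, 0 < ε → ∀ᶠ x in distinctPrimePairs, ∀ᶠ N : ℕ in atTop,
      ‖∑ n ∈ Icc 1 N, F (x.1 * n) * starRingEnd ℂ (F (x.2 * n))‖ ≤ ε * N) (hδ : 0 < δ) :
    ∀ᶠ N : ℕ in atTop, ‖∑ n ∈ Icc 1 N, F n * u n‖ ≤ 6 * δ * N := by
  obtain ⟨K, hK⟩ := eventually_distinctPrimePairs_iff.1 (hcor (δ ^ 2) (by positivity))
  obtain ⟨P, hP, hPA⟩ := exists_finset_primes_le_sum_inv (max K ⌈1 / δ⌉₊) (2 / δ ^ 2)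
  have hprime : ∀ p ∈ P, p.Prime := fun p hp => (hP p hp).1
  have hPK : ∀ p ∈ P, K ≤ p := fun p hp => (le_max_left _ _).trans (hP p hp).2
  have hPδ : ∀ p ∈ P, (p : ℝ)⁻¹ ≤ δ := fun p hp => by
    have hceil := Nat.le_of_ceil_le ((le_max_right _ _).trans (hP p hp).2)
    rw [one_div] at hceil
    exact inv_le_of_inv_le₀ hδ hceil
  have hcorP : ∀ᶠ N : ℕ in atTop, ∀ p ∈ P, ∀ q ∈ P, p ≠ q →
      ‖∑ m ∈ Icc 1 (min (N / p) (N / q)), F (p * m) * starRingEnd ℂ (F (q * m))‖ ≤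
        δ ^ 2 * (min (N / p) (N / q) : ℕ) := by
    refine (eventually_all_finset P).2 fun p hp => (eventually_all_finset P).2 fun q hq =>
      eventually_imp_distrib_left.2 fun hpq => ?_
    have hdiv : ∀ r ∈ P, Tendsto (fun N : ℕ => N / r) atTop atTop := fun r hr =>
      Nat.tendsto_div_const_atTop (hprime r hr).ne_zero
    have hmin : Tendsto (fun N : ℕ => min (N / p) (N / q)) atTop atTop :=
      tendsto_atTop.2 fun b => ((hdiv p hp).eventually_ge_atTop b).mp <|
        ((hdiv q hq).eventually_ge_atTop b).mono fun _ h h' => le_min h' h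
    exact hmin.eventually (hK p q (hprime p hp) (hprime q hq) hpq (hPK p hp) (hPK q hq))
  filter_upwards [hcorP, eventually_ge_atTop (2 * P.card)] with N hN hNP
  have hbound := sum_inv_mul_norm_sum_le hmul hu hF hprime hPδ hδ hNP hN
  set A := ∑ p ∈ P, (p : ℝ)⁻¹
  have hA : 0 < A := lt_of_lt_of_le (by positivity) hPA
  have hδA : 2 ≤ δ ^ 2 * A := by rwa [div_le_iff₀' (by positivity)] at hPA
  have hsqrt : √(2 * A) ≤ δ * A := Real.sqrt_le_iff.2 ⟨by positivity, by nlinarith⟩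
  have hinv : 1 / δ ≤ δ * A := by
    rw [div_le_iff₀ hδ]
    linarith
  refine le_of_mul_le_mul_left (hbound.trans ?_) hA
  calc N * (√(2 * A) + 4 * δ * A + 1 / δ) ≤ N * (δ * A + 4 * δ * A + δ * A) := by gcongr
    _ = A * (6 * δ * N) := by ring

/-- The **Kátai–Bourgain–Sarnak–Ziegler criterion**. -/
theorem isLittleO_sum_mul_of_isMultiplicative (hmul : u.IsMultiplicative) (hu : ∀ n, ‖u n‖ ≤ 1)
    {C : ℝ} (hF : ∀ n, ‖F n‖ ≤ C)
    (hcor : ∀ ε : ℝ, 0 < ε → ∀ᶠ x in distinctPrimePairs, ∀ᶠ N : ℕ in atTop,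
      ‖∑ n ∈ Icc 1 N, F (x.1 * n) * starRingEnd ℂ (F (x.2 * n))‖ ≤ ε * N) :
    (fun N : ℕ => ∑ n ∈ Icc 1 N, F n * u n) =o[atTop] fun N : ℕ => (N : ℂ) := by
  have hC : 0 < C + 1 := by linarith [(norm_nonneg _).trans (hF 0)]
  have hc : (C + 1 : ℂ) ≠ 0 := by exact_mod_cast hC.ne'
  have hnorm : ‖(C + 1 : ℂ)⁻¹‖ = (C + 1)⁻¹ := by
    rw [← Complex.ofReal_one, ← Complex.ofReal_add, norm_inv, Complex.norm_real,
      Real.norm_of_nonneg hC.le]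
  have hscaled : (fun N : ℕ => ∑ n ∈ Icc 1 N, (C + 1 : ℂ)⁻¹ * F n * u n) =o[atTop]
      fun N : ℕ => (N : ℂ) := by
    refine Asymptotics.isLittleO_iff.2 fun ε hε => ?_
    have h := eventually_norm_sum_mul_le (F := fun n => (C + 1 : ℂ)⁻¹ * F n) hmul hu ?_ ?_
      (δ := ε / 6) (by positivity)
    · simpa only [mul_div_cancel₀ ε (OfNat.ofNat_ne_zero 6), Complex.norm_natCast] using h
    · intro n
      rw [norm_mul, hnorm, inv_mul_le_one₀ hC]
      linarith [hF n]
    · intro η hη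
      filter_upwards [hcor (η * (C + 1) ^ 2) (by positivity)] with x hx
      filter_upwards [hx] with N hN
      simp only [map_mul, mul_mul_mul_comm _ (F _), ← Finset.mul_sum]
      rw [norm_mul, norm_mul, RCLike.norm_conj, hnorm, ← mul_inv, inv_mul_le_iff₀ (by positivity)]
      exact hN.trans_eq (by ring)
  refine (hscaled.const_mul_left (C + 1 : ℂ)).congr_left fun N => ?_
  simp only [mul_assoc, ← Finset.mul_sum, mul_inv_cancel_left₀ hc]

end OrthogonalityCriterion

section Tauberian

open Complex
open scoped FourierTransform SchwartzMap ContDiff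

/-- `f` is a bounded measurable function on the half line (extended by zero to `ℝ`) whose Laplace
transform, defined for `0 < re z`, extends to the continuous function `G` on `0 ≤ re z`. This is the
analytic hypothesis of Tauberian theorems. -/
structure HasLaplaceExtension (f : ℝ → ℂ) (G : ℂ → ℂ) : Prop where
  measurable : Measurable f
  bounded : ∃ C, ∀ u, ‖f u‖ ≤ C
  eq_zero_of_neg : ∀ u < 0, f u = 0
  continuousOn : ContinuousOn G {z | 0 ≤ z.re}
  integral_eq : ∀ z : ℂ, 0 < z.re → ∫ u : ℝ, f u * cexp (-(z * u)) = G z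

/-- The increments of `f` from `x` to any other point grow at most linearly with slope `L`, up to an
error tending to zero as `x → ∞`. This is the slow oscillation hypothesis of Tauberian theorems. -/
def IsAsymptoticallyLipschitz (L : ℝ) (f : ℝ → ℂ) : Prop :=
  ∀ ε > 0, ∀ᶠ x in atTop, ∀ u, ‖f u - f x‖ ≤ L * |u - x| + ε

variable {f : ℝ → ℂ} {G : ℂ → ℂ} {L : ℝ}

theorem IsAsymptoticallyLipschitz.comp_div (hf : IsAsymptoticallyLipschitz L f) {T : ℝ}
    (hT : 0 < T) : IsAsymptoticallyLipschitz (L / T) fun u => f (u / T) := by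
  intro ε hε
  filter_upwards [(tendsto_id.atTop_div_const hT).eventually (hf ε hε)] with x hx u
  calc ‖f (u / T) - f (x / T)‖ ≤ L * |u / T - x / T| + ε := hx (u / T)
    _ = L / T * |u - x| + ε := by rw [← sub_div, abs_div, abs_of_pos hT]; ring

namespace HasLaplaceExtension

theorem comp_div (hf : HasLaplaceExtension f G) {T : ℝ} (hT : 0 < T) :
    HasLaplaceExtension (fun u => f (u / T)) fun z => T * G (T * z) where
  measurable := hf.measurable.comp (measurable_id.div_const T)
  bounded := hf.bounded.imp fun _ hC u => hC (u / T)
  eq_zero_of_neg u hu := hf.eq_zero_of_neg _ (div_neg_of_neg_of_pos hu hT)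
  continuousOn := continuousOn_const.mul <| hf.continuousOn.comp (by fun_prop) fun z hz => by
    simpa using mul_nonneg hT.le hz
  integral_eq z hz := by
    have hscale := Measure.integral_comp_div (fun v : ℝ => f v * cexp (-(T * z * v))) T
    rw [hf.integral_eq _ (by simpa using mul_pos hT hz), abs_of_pos hT, real_smul] at hscale
    rw [← hscale]
    congr 1 with u
    have hT' : (T : ℂ) ≠ 0 := mod_cast hT.ne'
    push_cast
    congr 3
    field_simp

theorem norm_mul_exp_neg_le (hf : HasLaplaceExtension f G) {σ : ℝ} (hσ : 0 ≤ σ) (u : ℝ) :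
    ‖f u * cexp (-(σ * u))‖ ≤ ‖f u‖ := by
  rcases lt_or_ge u 0 with hu | hu
  · simp only [hf.eq_zero_of_neg u hu, zero_mul, norm_zero, le_refl]
  · rw [norm_mul, norm_exp]
    refine mul_le_of_le_one_right (norm_nonneg _) (Real.exp_le_one_iff.mpr ?_)
    simpa using mul_nonneg hσ hu

theorem integrable_mul_exp_neg (hf : HasLaplaceExtension f G) {σ : ℝ} (hσ : 0 < σ) :
    Integrable fun u : ℝ => f u * cexp (-(σ * u)) := by
  have hexp : IntegrableOn (fun u : ℝ => cexp (-(σ * u))) (Set.Ici 0) := by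
    rw [integrableOn_Ici_iff_integrableOn_Ioi]
    simpa using integrableOn_exp_mul_complex_Ioi (a := -(σ : ℂ)) (by simpa using hσ) 0
  obtain ⟨C, hC⟩ := hf.bounded
  refine ((integrable_indicator_iff measurableSet_Ici).mpr hexp).bdd_mul
    hf.measurable.aestronglyMeasurable (Eventually.of_forall hC) |>.congr
    (Eventually.of_forall fun u => ?_)
  rcases lt_or_ge u 0 with hu | hu
  · simp only [hf.eq_zero_of_neg u hu, zero_mul]
  · simp only [Set.indicator_of_mem (Set.mem_Ici.mpr hu)]

theorem integral_mul_exp_neg_mul_fourier (hf : HasLaplaceExtension f G) {φ : ℝ → ℂ}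
    (hφ : Integrable φ) {σ : ℝ} (hσ : 0 < σ) :
    ∫ u : ℝ, f u * cexp (-(σ * u)) * 𝓕 φ u = ∫ t : ℝ, G (σ + 2 * Real.pi * t * I) * φ t := by
  have hfourier (t : ℝ) : 𝓕 (fun u : ℝ => f u * cexp (-(σ * u))) t =
      G (σ + 2 * Real.pi * t * I) := by
    rw [← hf.integral_eq _ (by simpa using hσ), Real.fourier_real_eq_integral_exp_smul]
    congr 1 with u
    rw [smul_eq_mul, mul_left_comm, ← Complex.exp_add]
    push_cast
    ring_nf
  simp only [← hfourier]
  simpa using! (VectorFourier.integral_fourierIntegral_smul_eq_flip (L := innerₗ ℝ)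
    Real.continuous_fourierChar continuous_inner (hf.integrable_mul_exp_neg hσ) hφ).symm

theorem tendsto_integral_mul_exp_neg_mul (hf : HasLaplaceExtension f G) {K : ℝ → ℂ}
    (hK : Integrable K) :
    Tendsto (fun σ : ℝ => ∫ u : ℝ, f u * cexp (-(σ * u)) * K u) (𝓝[>] 0)
      (𝓝 (∫ u : ℝ, f u * K u)) := by
  obtain ⟨C, hC⟩ := hf.bounded
  refine tendsto_integral_filter_of_dominated_convergence (fun u => C * ‖K u‖)
    (Eventually.of_forall fun σ => ?_) ?_ (hK.norm.const_mul C) (Eventually.of_forall fun u => ?_)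
  · exact (hf.measurable.mul (by fun_prop)).aestronglyMeasurable.mul hK.aestronglyMeasurable
  · filter_upwards [self_mem_nhdsWithin] with σ hσ
    refine Eventually.of_forall fun u => ?_
    rw [norm_mul]
    gcongr
    exact (hf.norm_mul_exp_neg_le (le_of_lt hσ) u).trans (hC u)
  · have hcont : Continuous fun σ : ℝ => f u * cexp (-(σ * u)) * K u := by fun_prop
    simpa using (hcont.tendsto 0).mono_left nhdsWithin_le_nhds

theorem tendsto_integral_mul_of_hasCompactSupport (hf : HasLaplaceExtension f G) {φ : ℝ → ℂ}
    (hφ : Continuous φ) (hφc : HasCompactSupport φ) :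
    Tendsto (fun σ : ℝ => ∫ t : ℝ, G (σ + 2 * Real.pi * t * I) * φ t) (𝓝[>] 0)
      (𝓝 (∫ t : ℝ, G (2 * Real.pi * t * I) * φ t)) := by
  obtain ⟨C, hC⟩ : ∃ C, ∀ z ∈ Set.Icc (0 : ℝ) 1 ×ˢ tsupport φ,
      ‖G (z.1 + 2 * Real.pi * z.2 * I)‖ ≤ C :=
    (isCompact_Icc.prod hφc).exists_bound_of_continuousOn
      (hf.continuousOn.comp (by fun_prop) fun z hz => by simpa using hz.1.1)
  refine tendsto_integral_filter_of_dominated_convergence (fun t => C * ‖φ t‖) ?_ ?_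
    ((hφ.integrable_of_hasCompactSupport hφc).norm.const_mul C) (Eventually.of_forall fun t => ?_)
  · filter_upwards [self_mem_nhdsWithin] with σ hσ
    have hline : Continuous fun t : ℝ => G (σ + 2 * Real.pi * t * I) :=
      hf.continuousOn.comp_continuous (by fun_prop) fun t => by simpa using le_of_lt hσ
    exact (hline.mul hφ).aestronglyMeasurable
  · filter_upwards [Ioo_mem_nhdsGT zero_lt_one] with σ hσ
    refine Eventually.of_forall fun t => ?_
    by_cases ht : t ∈ tsupport φ
    · rw [norm_mul]
      gcongr
      exact hC (σ, t) ⟨⟨hσ.1.le, hσ.2.le⟩, ht⟩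
    · simp only [image_eq_zero_of_notMem_tsupport ht, mul_zero, norm_zero, le_refl]
  · have hline : ContinuousOn (fun σ : ℝ => G (σ + 2 * Real.pi * t * I)) (Set.Ici 0) :=
      hf.continuousOn.comp (by fun_prop) fun σ hσ => by simpa using hσ
    have hlim := ((hline 0 Set.self_mem_Ici).mono Set.Ioi_subset_Ici_self).tendsto
    rw [ofReal_zero, zero_add] at hlim
    exact hlim.mul_const (φ t)

theorem integral_mul_fourier (hf : HasLaplaceExtension f G) {φ : ℝ → ℂ} (hφ : Continuous φ)
    (hφc : HasCompactSupport φ) (hφi : Integrable (𝓕 φ)) :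
    ∫ u : ℝ, f u * 𝓕 φ u = ∫ t : ℝ, G (2 * Real.pi * t * I) * φ t := by
  refine tendsto_nhds_unique (hf.tendsto_integral_mul_exp_neg_mul hφi)
    ((hf.tendsto_integral_mul_of_hasCompactSupport hφ hφc).congr' ?_)
  filter_upwards [self_mem_nhdsWithin] with σ hσ
  exact (hf.integral_mul_exp_neg_mul_fourier (hφ.integrable_of_hasCompactSupport hφc) hσ).symm

theorem tendsto_integral_mul_fourier_sub (hf : HasLaplaceExtension f G) {φ : ℝ → ℂ}
    (hφ : Continuous φ) (hφc : HasCompactSupport φ) (hφi : Integrable (𝓕 φ)) :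
    Tendsto (fun x : ℝ => ∫ u : ℝ, f u * 𝓕 φ (u - x)) atTop (𝓝 0) := by
  have hmodulation (x u : ℝ) :
      𝓕 (fun t : ℝ => cexp (2 * Real.pi * t * x * I) * φ t) u = 𝓕 φ (u - x) := by
    simp only [Real.fourier_real_eq_integral_exp_smul]
    congr 1 with t
    rw [smul_eq_mul, smul_eq_mul, ← mul_assoc, ← Complex.exp_add]
    push_cast
    ring_nf
  have hriemannLebesgue := (Real.zero_at_infty_fourier fun t : ℝ =>
    G (2 * Real.pi * t * I) * φ t).comp (tendsto_neg_atTop_atBot.mono_right atBot_le_cocompact)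
  refine hriemannLebesgue.congr fun x => ?_
  have hshift := hf.integral_mul_fourier (φ := fun t : ℝ => cexp (2 * Real.pi * t * x * I) * φ t)
    (by fun_prop) hφc.mul_left
    (by simpa only [funext (hmodulation x)] using hφi.comp_sub_right x)
  simp only [hmodulation x] at hshift
  rw [hshift, Function.comp_apply, Real.fourier_real_eq_integral_exp_smul]
  congr 1 with t
  rw [smul_eq_mul, mul_left_comm]
  push_cast
  ring_nf

end HasLaplaceExtension

theorem exists_schwartz_integral_fourier_eq_one :
    ∃ φ : 𝓢(ℝ, ℂ), HasCompactSupport φ ∧ ∫ w, (𝓕 φ) w = 1 := by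
  let b : ContDiffBump (0 : ℝ) := default
  have hbc : HasCompactSupport (fun t => (b t : ℂ)) := b.hasCompactSupport.comp_left ofReal_zero
  let φ : 𝓢(ℝ, ℂ) := hbc.toSchwartzMap (ofRealCLM.contDiff.comp b.contDiff)
  refine ⟨φ, hbc, ?_⟩
  have hinversion : (𝓕⁻ (𝓕 φ)) (0 : ℝ) = φ 0 := by rw [FourierTransform.fourierInv_fourier_eq]
  rw [SchwartzMap.fourierInv_coe, Real.fourierInv_eq] at hinversion
  simp only [inner_zero_right, AddChar.map_zero_eq_one, one_smul] at hinversion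
  rw [hinversion]
  change ((b 0 : ℝ) : ℂ) = 1
  rw [b.one_of_mem_closedBall (Metric.mem_closedBall_self b.rIn_pos.le), ofReal_one]

theorem IsAsymptoticallyLipschitz.eventually_norm_le (hlip : IsAsymptoticallyLipschitz L f)
    (hfm : Measurable f) {C : ℝ} (hfC : ∀ u, ‖f u‖ ≤ C) {K : ℝ → ℂ} (hK : Integrable K)
    (hKmoment : Integrable fun w => |w| * ‖K w‖) (hKone : ∫ w, K w = 1)
    (hconv : Tendsto (fun x : ℝ => ∫ u : ℝ, f u * K (u - x)) atTop (𝓝 0)) {ε : ℝ} (hε : 0 < ε) :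
    ∀ᶠ x in atTop, ‖f x‖ ≤ L * (∫ w, |w| * ‖K w‖) + ε := by
  set δ := ε / (2 * (1 + ∫ w, ‖K w‖)) with hδdef
  have hδ : 0 < δ := by positivity
  have hδmass : δ * (∫ w, ‖K w‖) ≤ ε / 2 := by
    rw [hδdef, div_mul_eq_mul_div, div_le_iff₀ (by positivity)]
    nlinarith
  filter_upwards [hlip δ hδ, hconv.norm.eventually_le_const (u := ε / 2) (by simpa using hε)]
    with x hx hxconv
  have hint : Integrable fun u : ℝ => f u * K (u - x) :=
    (hK.comp_sub_right x).bdd_mul hfm.aestronglyMeasurable (Eventually.of_forall hfC)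
  have hsplit : f x = (∫ u, f u * K (u - x)) - ∫ u, (f u - f x) * K (u - x) := by
    simp only [sub_mul]
    rw [integral_sub hint ((hK.comp_sub_right x).const_mul _), integral_const_mul,
      integral_sub_right_eq_self K x, hKone]
    ring
  have hdiff : ‖∫ u, (f u - f x) * K (u - x)‖ ≤
      L * (∫ w, |w| * ‖K w‖) + δ * ∫ w, ‖K w‖ := by
    have hmajorant : Integrable fun w => L * (|w| * ‖K w‖) + δ * ‖K w‖ :=
      (hKmoment.const_mul L).add (hK.norm.const_mul δ)
    rw [← integral_const_mul, ← integral_const_mul,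
      ← integral_add (hKmoment.const_mul L) (hK.norm.const_mul δ),
      ← integral_sub_right_eq_self (fun w => L * (|w| * ‖K w‖) + δ * ‖K w‖) x]
    refine norm_integral_le_of_norm_le (hmajorant.comp_sub_right x)
      (Eventually.of_forall fun u => ?_)
    rw [norm_mul]
    exact (mul_le_mul_of_nonneg_right (hx u) (norm_nonneg _)).trans_eq (by ring)
  calc ‖f x‖ ≤ ‖∫ u, f u * K (u - x)‖ + ‖∫ u, (f u - f x) * K (u - x)‖ := by
        conv_lhs => rw [hsplit]
        exact norm_sub_le _ _
    _ ≤ L * (∫ w, |w| * ‖K w‖) + ε := by linarith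

/- The estimate for a fixed kernel only bounds `f` by a multiple of `L`; dilating `f` makes `L`
arbitrarily small. -/
theorem HasLaplaceExtension.tendsto_zero (hf : HasLaplaceExtension f G)
    (hlip : IsAsymptoticallyLipschitz L f) : Tendsto f atTop (𝓝 0) := by
  obtain ⟨φ, hφc, hφone⟩ := exists_schwartz_integral_fourier_eq_one
  have hmoment : Integrable fun w : ℝ => |w| * ‖𝓕 φ w‖ := by
    simpa only [pow_one, Real.norm_eq_abs] using (𝓕 φ : 𝓢(ℝ, ℂ)).integrable_pow_mul volume 1
  set M := ∫ w : ℝ, |w| * ‖𝓕 φ w‖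
  have hdilated (T : ℝ) (hT : 0 < T) (ε : ℝ) (hε : 0 < ε) :
      ∀ᶠ x in atTop, ‖f x‖ ≤ L / T * M + ε := by
    have hfT := hf.comp_div hT
    obtain ⟨C, hC⟩ := hfT.bounded
    have hbound := (hlip.comp_div hT).eventually_norm_le hfT.measurable hC (𝓕 φ).integrable
      hmoment hφone (by
        simpa only [SchwartzMap.fourier_coe] using hfT.tendsto_integral_mul_fourier_sub φ.continuous
          hφc (by simpa only [SchwartzMap.fourier_coe] using (𝓕 φ).integrable)) hε
    filter_upwards [(tendsto_id.const_mul_atTop hT).eventually hbound] with x hx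
    simpa only [id_eq, mul_div_cancel_left₀ x hT.ne'] using hx
  rw [Metric.tendsto_nhds]
  intro ε hε
  have hsmall : ∀ᶠ T : ℝ in atTop, L / T * M < ε / 2 := by
    have hlim := (tendsto_id.const_div_atTop L).mul_const M
    rw [zero_mul] at hlim
    exact hlim.eventually_lt_const (half_pos hε)
  obtain ⟨T, hTM, hT⟩ := (hsmall.and (eventually_gt_atTop 0)).exists
  filter_upwards [hdilated T hT (ε / 2) (half_pos hε)] with x hx
  rw [dist_zero_right]
  linarith

end Tauberian

section DirichletSeries

open Finset (Icc)

variable {a : ℕ → ℂ} {C : ℝ}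

/-- The mean value `x⁻¹ ∑ k ≤ x, a k` in the exponential scale `x = exp u`, in which the Dirichlet
series of `a` becomes a Laplace transform. -/
noncomputable def exponentialMean (a : ℕ → ℂ) (u : ℝ) : ℂ :=
  Real.exp (-u) * ∑ k ∈ Icc 1 ⌊Real.exp u⌋₊, a k

theorem measurable_exponentialMean : Measurable (exponentialMean a) :=
  Measurable.mul (by fun_prop) <| (measurable_from_nat (f := fun n : ℕ => ∑ k ∈ Icc 1 n, a k)).comp
    (Nat.measurable_floor.comp Real.measurable_exp)

theorem exponentialMean_of_neg {u : ℝ} (hu : u < 0) : exponentialMean a u = 0 := by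
  rw [exponentialMean, Nat.floor_eq_zero.mpr (Real.exp_lt_one_iff.mpr hu),
    Finset.Icc_eq_empty_of_lt one_pos, Finset.sum_empty, mul_zero]

theorem exponentialMean_log {N : ℕ} (hN : 0 < N) :
    exponentialMean a (Real.log N) = 1 / (N : ℂ) * ∑ k ∈ Icc 1 N, a k := by
  rw [exponentialMean, Real.exp_neg, Real.exp_log (by exact_mod_cast hN), Nat.floor_natCast,
    Complex.ofReal_inv, Complex.ofReal_natCast, one_div]

theorem norm_sum_Icc_le {E : Type*} [SeminormedAddCommGroup E] {b : ℕ → E} (hb : ∀ n, ‖b n‖ ≤ C)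
    (N : ℕ) : ‖∑ k ∈ Icc 1 N, b k‖ ≤ C * N :=
  (norm_sum_le_of_le _ fun k _ => hb k).trans_eq (by simp [mul_comm])

theorem norm_sum_Icc_sub_le {E : Type*} [SeminormedAddCommGroup E] {b : ℕ → E}
    (hb : ∀ n, ‖b n‖ ≤ C) {m n : ℕ} (hmn : m ≤ n) :
    ‖∑ k ∈ Icc 1 n, b k - ∑ k ∈ Icc 1 m, b k‖ ≤ C * (n - m) := by
  have hsub : Icc 1 m ⊆ Icc 1 n := Finset.Icc_subset_Icc_right hmn
  rw [← Finset.sum_sdiff hsub, add_sub_cancel_right]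
  refine (norm_sum_le_of_le _ fun k _ => hb k).trans_eq ?_
  rw [Finset.sum_const, nsmul_eq_mul, Finset.card_sdiff_of_subset hsub]
  simp [Nat.cast_sub hmn, mul_comm]

theorem norm_exponentialMean_le (ha : ∀ n, ‖a n‖ ≤ C) (u : ℝ) : ‖exponentialMean a u‖ ≤ C := by
  have hC : 0 ≤ C := (norm_nonneg _).trans (ha 0)
  rw [exponentialMean, norm_mul, Complex.norm_real, Real.norm_of_nonneg (Real.exp_pos _).le,
    Real.exp_neg, inv_mul_le_iff₀ (Real.exp_pos u), mul_comm _ C]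
  refine (norm_sum_Icc_le ha _).trans ?_
  gcongr
  exact Nat.floor_le (Real.exp_pos u).le

theorem norm_exponentialMean_sub_le (ha : ∀ n, ‖a n‖ ≤ C) {s t : ℝ} (hst : s ≤ t) :
    ‖exponentialMean a t - exponentialMean a s‖ ≤ C * (2 * (t - s) + Real.exp (-t)) := by
  have hC : 0 ≤ C := (norm_nonneg _).trans (ha 0)
  set m := ⌊Real.exp s⌋₊
  set n := ⌊Real.exp t⌋₊
  have hn : (n : ℝ) ≤ Real.exp t := Nat.floor_le (Real.exp_pos t).le
  have hm : (m : ℝ) ≤ Real.exp s := Nat.floor_le (Real.exp_pos s).le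
  have hm' : Real.exp s < m + 1 := Nat.lt_floor_add_one _
  have hanti : 0 ≤ Real.exp (-s) - Real.exp (-t) :=
    sub_nonneg.mpr (Real.exp_le_exp.mpr (neg_le_neg hst))
  have hsplit : exponentialMean a t - exponentialMean a s =
      Real.exp (-t) * (∑ k ∈ Icc 1 n, a k - ∑ k ∈ Icc 1 m, a k) -
        (Real.exp (-s) - Real.exp (-t) : ℝ) * ∑ k ∈ Icc 1 m, a k := by
    rw [exponentialMean, exponentialMean]
    push_cast
    ring
  have hs : Real.exp (-s) * Real.exp s = 1 := by rw [← Real.exp_add, neg_add_cancel, Real.exp_zero]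
  have ht : Real.exp (-t) * Real.exp t = 1 := by rw [← Real.exp_add, neg_add_cancel, Real.exp_zero]
  have hts : Real.exp (-t) * Real.exp s = Real.exp (s - t) := by rw [← Real.exp_add, neg_add_eq_sub]
  calc ‖exponentialMean a t - exponentialMean a s‖
      ≤ Real.exp (-t) * (C * (n - m)) + (Real.exp (-s) - Real.exp (-t)) * (C * m) := by
        rw [hsplit]
        refine (norm_sub_le _ _).trans ?_
        rw [norm_mul, norm_mul, Complex.norm_real, Complex.norm_real, Real.norm_of_nonneg hanti,
          Real.norm_of_nonneg (Real.exp_pos _).le]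
        gcongr
        · exact norm_sum_Icc_sub_le ha (Nat.floor_le_floor (Real.exp_le_exp.mpr hst))
        · exact norm_sum_Icc_le ha m
    _ ≤ Real.exp (-t) * (C * (Real.exp t - (Real.exp s - 1))) +
          (Real.exp (-s) - Real.exp (-t)) * (C * Real.exp s) := by
        gcongr
        linarith
    _ = C * (2 * (1 - Real.exp (s - t)) + Real.exp (-t)) := by
        linear_combination C * (ht + hs - 2 * hts)
    _ ≤ C * (2 * (t - s) + Real.exp (-t)) := by
        refine mul_le_mul_of_nonneg_left ?_ hC
        linarith [Real.add_one_le_exp (s - t)]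

theorem isAsymptoticallyLipschitz_exponentialMean (ha : ∀ n, ‖a n‖ ≤ C) :
    IsAsymptoticallyLipschitz (2 * C) (exponentialMean a) := by
  intro ε hε
  have hC : 0 ≤ C := (norm_nonneg _).trans (ha 0)
  have hlim : Tendsto (fun x : ℝ => C * Real.exp (-x)) atTop (𝓝 0) := by
    simpa only [mul_zero] using Real.tendsto_exp_neg_atTop_nhds_zero.const_mul C
  filter_upwards [hlim.eventually_le_const hε] with x hx u
  have hbound : ‖exponentialMean a u - exponentialMean a x‖ ≤
      C * (2 * |u - x| + Real.exp (-x)) := by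
    rcases le_total u x with h | h
    · rw [norm_sub_rev, abs_sub_comm, abs_of_nonneg (sub_nonneg.mpr h)]
      exact norm_exponentialMean_sub_le ha h
    · rw [abs_of_nonneg (sub_nonneg.mpr h)]
      refine (norm_exponentialMean_sub_le ha h).trans ?_
      gcongr
  linarith

theorem integral_exponentialMean_mul_exp (ha : ∀ n, ‖a n‖ ≤ C) {z : ℂ} (hz : 0 < z.re) :
    ∫ u : ℝ, exponentialMean a u * Complex.exp (-(z * u)) = LSeries a (1 + z) / (1 + z) := by
  have hs : 1 < (1 + z).re := by simpa using hz
  have hs0 : 1 + z ≠ 0 := by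
    intro h
    rw [h, Complex.zero_re] at hs
    linarith
  have hO : (fun n : ℕ => ∑ k ∈ Icc 1 n, ‖a k‖) =O[atTop] fun n => (n : ℝ) ^ (1 : ℝ) := by
    refine Asymptotics.IsBigO.of_bound C (Eventually.of_forall fun n => ?_)
    simpa using norm_sum_Icc_le (b := fun n => ‖a n‖) (by simpa using ha) n
  rw [LSeries_eq_mul_integral' a zero_le_one hs hO, mul_div_cancel_left₀ _ hs0, ← Real.exp_zero,
    ← Real.image_exp_Ioi, integral_image_eq_integral_abs_deriv_smul measurableSet_Ioi
      (fun x _ => (Real.hasDerivAt_exp x).hasDerivWithinAt) Real.exp_injective.injOn,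
    ← integral_Ici_eq_integral_Ioi, ← integral_indicator measurableSet_Ici]
  congr 1 with u
  rcases lt_or_ge u 0 with hu | hu
  · rw [Set.indicator_of_notMem (by simpa using hu), exponentialMean_of_neg hu, zero_mul]
  · have hpow : (Real.exp (-u) : ℂ) * Complex.exp (-(z * u)) =
        Real.exp u * (Real.exp u : ℂ) ^ (-(1 + z + 1)) := by
      rw [Complex.cpow_def_of_ne_zero (by exact_mod_cast (Real.exp_pos u).ne'),
        ← Complex.ofReal_log (Real.exp_pos u).le, Real.log_exp, Complex.ofReal_exp,
        Complex.ofReal_exp, ← Complex.exp_add, ← Complex.exp_add]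
      congr 1
      push_cast
      ring
    rw [Set.indicator_of_mem (Set.mem_Ici.mpr hu), exponentialMean, abs_of_pos (Real.exp_pos u),
      Complex.real_smul]
    linear_combination (∑ k ∈ Icc 1 ⌊Real.exp u⌋₊, a k) * hpow

theorem hasLaplaceExtension_exponentialMean {H : ℂ → ℂ} (ha : ∀ n, ‖a n‖ ≤ C)
    (hH : ContinuousOn H {s | 1 ≤ s.re}) (hLH : ∀ s : ℂ, 1 < s.re → LSeries a s = H s) :
    HasLaplaceExtension (exponentialMean a) fun z => H (1 + z) / (1 + z) where
  measurable := measurable_exponentialMean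
  bounded := ⟨C, norm_exponentialMean_le ha⟩
  eq_zero_of_neg _ hu := exponentialMean_of_neg hu
  continuousOn := by
    refine ContinuousOn.div (hH.comp (by fun_prop) fun z hz => by simpa using hz) (by fun_prop)
      fun z hz h => ?_
    have hre := congrArg Complex.re h
    rw [Complex.add_re, Complex.one_re, Complex.zero_re] at hre
    linarith [show 0 ≤ z.re from hz]
  integral_eq z hz := by
    rw [integral_exponentialMean_mul_exp ha hz, hLH _ (by simpa using hz)]

theorem isLittleO_natCast_iff_tendsto {g : ℕ → ℂ} :
    g =o[atTop] (fun N : ℕ => (N : ℂ)) ↔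
      Tendsto (fun N : ℕ => (1 / (N : ℂ)) * g N) atTop (𝓝 0) := by
  rw [Asymptotics.isLittleO_iff_tendsto' ((eventually_ne_atTop 0).mono fun N hN h =>
    absurd (Nat.cast_eq_zero.mp h) hN)]
  simp only [one_div_mul_eq_div]

/-- The **Wiener–Ikehara theorem** for Dirichlet series with bounded coefficients. -/
theorem isLittleO_sum_of_LSeries_continuousOn {H : ℂ → ℂ} (ha : ∀ n, ‖a n‖ ≤ C)
    (hH : ContinuousOn H {s | 1 ≤ s.re}) (hLH : ∀ s : ℂ, 1 < s.re → LSeries a s = H s) :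
    (fun N : ℕ => ∑ n ∈ Icc 1 N, a n) =o[atTop] fun N : ℕ => (N : ℂ) := by
  have hlim := ((hasLaplaceExtension_exponentialMean ha hH hLH).tendsto_zero
    (isAsymptoticallyLipschitz_exponentialMean ha)).comp
    (Real.tendsto_log_atTop.comp tendsto_natCast_atTop_atTop)
  refine isLittleO_natCast_iff_tendsto.mpr (hlim.congr' ?_)
  filter_upwards [eventually_gt_atTop 0] with N hN
  exact exponentialMean_log hN

end DirichletSeries

section Moebius

open ArithmeticFunction (moebius)

theorem norm_moebius_le_one (n : ℕ) : ‖(moebius n : ℂ)‖ ≤ 1 := by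
  rw [Complex.norm_intCast]
  exact_mod_cast ArithmeticFunction.abs_moebius_le_one

theorem continuousOn_update_inv_riemannZeta :
    ContinuousOn (Function.update (fun s => (riemannZeta s)⁻¹) 1 0) {s | 1 ≤ s.re} := by
  intro s hs
  refine ContinuousAt.continuousWithinAt ?_
  rcases eq_or_ne s 1 with rfl | hs1
  · have hlim : Tendsto (fun s : ℂ => (s - 1) * ((s - 1) * riemannZeta s)⁻¹) (𝓝[≠] 1)
        (𝓝 ((1 - 1) * 1⁻¹)) :=
      ((continuous_sub_right (1 : ℂ)).continuousAt.continuousWithinAt.tendsto).mul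
        (riemannZeta_residue_one.inv₀ one_ne_zero)
    rw [sub_self, zero_mul] at hlim
    refine continuousAt_update_same.mpr (hlim.congr' ?_)
    filter_upwards [self_mem_nhdsWithin] with s hs
    rw [mul_inv, mul_inv_cancel_left₀ (sub_ne_zero.mpr hs)]
  · rw [continuousAt_update_of_ne hs1]
    exact (differentiableAt_riemannZeta hs1).continuousAt.inv₀
      (riemannZeta_ne_zero_of_one_le_re hs)

theorem isLittleO_sum_moebius :
    (fun N : ℕ => ∑ n ∈ Finset.Icc 1 N, (moebius n : ℂ)) =o[atTop] fun N : ℕ => (N : ℂ) := by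
  refine isLittleO_sum_of_LSeries_continuousOn norm_moebius_le_one
    continuousOn_update_inv_riemannZeta fun s hs => ?_
  have hs1 : s ≠ 1 := by
    rintro rfl
    exact hs.ne' Complex.one_re
  rw [Function.update_of_ne hs1, ← LSeries_one_eq_riemannZeta hs]
  exact eq_inv_of_mul_eq_one_right (LSeries_one_mul_Lseries_moebius hs)

end Moebius

theorem HasQuasiDiscreteSpectrum.isLittleO_sum_mul {Y : Type*} [TopologicalSpace Y]
    [TopologicalSpace.MetrizableSpace Y] [CompactSpace Y] [MeasurableSpace Y] [BorelSpace Y]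
    {S : Y → Y} {ν : Measure Y} [IsProbabilityMeasure ν]
    (hqds : HasQuasiDiscreteSpectrum S ν) (hS : Continuous S) (hue : IsUniquelyErgodic S)
    (hν : MeasurePreserving S ν ν) {u : ArithmeticFunction ℂ} (hmul : u.IsMultiplicative)
    (hu : ∀ n, ‖u n‖ ≤ 1) (f : C(Y, ℂ)) (hf : ∫ x, f x ∂ν = 0) (y : Y) :
    (fun N : ℕ => ∑ n ∈ Finset.Icc 1 N, f (S^[n] y) * u n) =o[atTop] fun N : ℕ => (N : ℂ) :=
  isLittleO_sum_mul_of_isMultiplicative hmul hu (fun n => f.norm_coe_le_norm (S^[n] y))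
    fun _ hε => hqds.eventually_norm_sum_mul_conj_le hue hν hS f hf y hε

theorem theorem1 {Y : Type*} [MetricSpace Y] [CompactSpace Y] [MeasurableSpace Y] [BorelSpace Y]
    (S : Y → Y) (hS : Continuous S) (hue : IsUniquelyErgodic S)
    (ν : Measure Y) [IsProbabilityMeasure ν] (hν : MeasurePreserving S ν ν)
    (hqds : HasQuasiDiscreteSpectrum S ν) :
    (∀ u : ArithmeticFunction ℂ, u.IsMultiplicative → (∀ n, ‖u n‖ ≤ 1) →
      ∀ f : C(Y, ℂ), ∫ x, f x ∂ν = 0 → ∀ y : Y,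
        Filter.Tendsto (fun N : ℕ => (1 / (N : ℂ)) * ∑ n ∈ Finset.Icc 1 N, f (S^[n] y) * u n)
          Filter.atTop (nhds 0)) ∧
    (∀ f : C(Y, ℂ), ∀ y : Y,
        Filter.Tendsto (fun N : ℕ => (1 / (N : ℂ)) *
            ∑ n ∈ Finset.Icc 1 N, f (S^[n] y) * (ArithmeticFunction.moebius n : ℂ))
          Filter.atTop (nhds 0)) := by
  refine ⟨fun u hmul hu f hf y => isLittleO_natCast_iff_tendsto.mp
    (hqds.isLittleO_sum_mul hS hue hν hmul hu f hf y), fun f y => ?_⟩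
  set c := ∫ x, f x ∂ν
  have hcentered : ∫ x, (f - ContinuousMap.const Y c) x ∂ν = 0 := by
    have hf : Integrable f ν := f.continuous.integrable_of_hasCompactSupport (.of_compactSpace f)
    simp only [ContinuousMap.sub_apply, ContinuousMap.const_apply]
    rw [integral_sub hf (integrable_const c), integral_const, probReal_univ, one_smul, sub_self]
  have hmoebius := hqds.isLittleO_sum_mul hS hue hν
    ArithmeticFunction.isMultiplicative_moebius.intCast norm_moebius_le_one _ hcentered y
  refine isLittleO_natCast_iff_tendsto.mp
    ((hmoebius.add (isLittleO_sum_moebius.const_mul_left c)).congr_left fun N => ?_)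
  rw [Finset.mul_sum, ← Finset.sum_add_distrib]
  refine Finset.sum_congr rfl fun n _ => ?_
  simp only [ContinuousMap.sub_apply, ContinuousMap.const_apply, ArithmeticFunction.intCoe_apply]
  ring
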